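/- \textbf{Matching Discovery.} Let $G$ be a finite simple undirected graph. A configuration is a set of edges of $G$ (the edges that carry a token). A token slide replaces a configuration $C$ by $(C\setminus\{y\})\cup\{x\}$, where $y\in C$ and $x\in E(G)\setminus C$ is an edge sharing a vertex with $y$. In the Matching Discovery problem (token sliding model) one is given $G$, a set $S\subseteq E(G)$ with $|S|=k$, and an integer $b\ge 0$, and asks whether there are $\ell\le b$ and configurations $S=C_0,C_1,\dots,C_\ell$ such that each $C_{i+1}$ arises from $C_i$ by one token slide and $C_\ell$ is a matching of $G$ of size $k$. \textbf{Statement.} Matching Discovery in the token sliding model is fixed-parameter tractable with respect to the parameter $k=|S|$. That is, there are a Turing machine, a computable function $f:\mathbb N\to\mathbb N$ and a constant $c$ such that, given any word $x\in\{0,1\}^*$ and any $k\in\mathbb N$, the machine decides in at most $f(k)\cdot|(x,k)|^{c}$ steps whether $x$ encodes a yes-instance $(G,S,b)$ of Matching Discovery with $|S|=k$. Here $G$ and $S$ are encoded by their adjacency matrices on the vertex set $\{0,\dots,n-1\}$ (preceded by $n$ in unary), $b$ is encoded in binary, and $|(x,k)|=|x|+k+1$ (the parameter is given in unary, followed by a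 delimiter). -/

import Mathlib

/-! ### Parameterized problems and fixed-parameter tractability -/

/-- A parameterized problem over the alphabet `{0, 1}`: a set of pairs consisting of a word and a
parameter. -/
abbrev ParameterizedProblem : Type := Set (List Bool × ℕ)

/-- The word which is given to a machine as the instance `(x, κ)`: the parameter in unary, a
delimiter, and the word `x`.  Its length is `|x| + κ + 1`. -/
def instanceWord (x : List Bool) (κ : ℕ) : List Bool :=
  List.replicate κ true ++ false :: x

/-- Started with the word `w` on its input stack, the machine `M` halts after at most `t` steps
with the one-letter word `r` on its output stack. -/
def AnswersWithin (M : Turing.TM2ComputableAux Bool Bool) (w : List Bool) (r : Bool) (t : ℕ) :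
    Prop :=
  Nonempty (Turing.TM2OutputsInTime M.tm (w.map M.inputAlphabet.symm)
    (some ([r].map M.outputAlphabet.symm)) t)

/-- `L` is fixed-parameter tractable: some Turing machine (with finitely many stacks, all of them
over finite alphabets) decides on every input `(x, κ)` whether `(x, κ) ∈ L` within
`f κ * |(x, κ)| ^ c` steps, for a computable function `f` and a constant `c`. -/
def ParameterizedProblem.IsFPT (L : ParameterizedProblem) : Prop :=
  ∃ (M : Turing.TM2ComputableAux Bool Bool) (f : ℕ → ℕ) (c : ℕ),
    (∀ i, Finite (M.tm.Γ i)) ∧ Computable f ∧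
    ∀ (x : List Bool) (κ : ℕ), ∃ r : Bool, (r = true ↔ (x, κ) ∈ L) ∧
      AnswersWithin M (instanceWord x κ) r (f κ * (instanceWord x κ).length ^ c)

/-! ### Token sliding on edges -/

section Sliding

variable {V : Type} [DecidableEq V]

/-- One token slide: the token on the edge `y` moves to an unoccupied edge `x` of `G` that shares
a vertex with `y`. -/
def TokenSlide (G : SimpleGraph V) (C C' : Finset (Sym2 V)) : Prop :=
  ∃ y ∈ C, ∃ x ∈ G.edgeSet, x ∉ C ∧ (∃ v, v ∈ x ∧ v ∈ y) ∧ C' = insert x (C.erase y)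

/-- `M` is a matching of `G`, given as a set of edges. -/
def IsEdgeMatching (G : SimpleGraph V) (M : Finset (Sym2 V)) : Prop :=
  (∀ e ∈ M, e ∈ G.edgeSet) ∧ ∀ e ∈ M, ∀ e' ∈ M, e ≠ e' → ∀ v, v ∈ e → v ∉ e'

/-- A matching of size `|S|` can be discovered in `G`, starting from `S`, by a sequence
`C 0, …, C l` of token slides of length `l ≤ b`. -/
def MatchingDiscoverable (G : SimpleGraph V) (S : Finset (Sym2 V)) (b : ℕ) : Prop :=
  ∃ l ≤ b, ∃ C : ℕ → Finset (Sym2 V),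
    C 0 = S ∧ (∀ i < l, TokenSlide G (C i) (C (i + 1))) ∧
    IsEdgeMatching G (C l) ∧ (C l).card = S.card

end Sliding

/-! ### The problem Matching Discovery -/

/-- An instance `(G, S, b)`: a finite simple graph on the vertices `0, …, n - 1`, a set of edges
(the starting configuration) and a budget. -/
structure MatchingDiscoveryInstance where
  n : ℕ
  G : SimpleGraph (Fin n)
  S : Finset (Sym2 (Fin n))
  S_subset : ∀ e ∈ S, e ∈ G.edgeSet
  b : ℕ

/-- The bits of an `n × n` matrix of truth values, row by row. -/
noncomputable def matrixBits {n : ℕ} (R : Fin n → Fin n → Prop) : List Bool :=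
  open Classical in
  (List.finRange n).flatMap fun u => (List.finRange n).map fun v => decide (R u v)

/-- The word that represents an instance: the number of vertices in unary and a delimiter, the
adjacency matrix of `G`, the adjacency matrix of `S`, and the budget in binary (least significant
bit first, no leading zeros). -/
noncomputable def MatchingDiscoveryInstance.encode (I : MatchingDiscoveryInstance) : List Bool :=
  List.replicate I.n true ++ false ::
    (matrixBits I.G.Adj ++ matrixBits (fun u v => s(u, v) ∈ I.S) ++ I.b.bits)

/-- Matching Discovery in the token sliding model, parameterized by the number `k = |S|` of
tokens. -/
def matchingDiscoverySliding : ParameterizedProblem :=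
  {p | ∃ I : MatchingDiscoveryInstance, I.encode = p.1 ∧ I.S.card = p.2 ∧
    MatchingDiscoverable I.G I.S I.b}

/-! Combinatorics. A slide moves a token to an adjacent vertex of the line graph (`edgeGraph`).
Tokens are indistinguishable, so the least number of slides from `S` to `T` is the minimum, over
bijections `S → T`, of the sum of line graph distances. A slide lowers this minimum by at most one
(`Assignable.of_slide`); conversely, if the token that should move is blocked by another one, the
two exchange targets without increasing the cost (`exists_slide_of_free`). Hence only a matching and
a bijection onto it of total cost at most `b` have to be found (`matchingDiscoverable_iff`).

Each of the `k` tokens then gets a short list of candidate targets. Put `D = 2 * k`. The target of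
one token has to avoid the ends of the other `k - 1` targets, a set `X` of fewer than `D` vertices.
Edges are searched in order of distance from the token, and a new edge is kept only if fewer than
`D` kept edges lie at each of its ends and at most `D * D` edges have been kept so far. A rejected
edge that avoids `X` is dispensable: `D` kept edges at a common end outside `X` have `D` different
other ends, not all in `X`; and fewer than `D` vertices, each on at most `D` kept edges, cannot hit
more than `D * D` of them. So some candidate that is no farther away also avoids `X`
(`IsCandidateList.represents`), and the targets of any solution can be replaced by candidates one at
a time (`exists_candidates`). It suffices to try all choices from `k` lists of length at most `D * D
+ 1` (`assignable_iff_exists_section`).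

Running time. Structured programs with exact step counts compile to stack machines
(`Exec.simulate`). All data are binary trees, written in Polish notation on one stack. The functions
computable in polynomial time on trees are closed under composition, pairing, case distinction and
folds whose states stay polynomially small; this lets `fun_prop` verify the concrete functions.
`PolyTimeIn` allows a second measure besides the size, through which the number of choices enters
(`polyTimeIn_sections`). Numbers are unary trees whereas the budget is binary, so the budget is
evaluated only up to the cost with which it is compared (`cappedValue`). -/

/-! ### A structured programming language on four stacks -/

/-- The contents of the four stacks. -/
abbrev Stacks : Type := Fin 4 → List Bool

/-- Structured programs that work on four stacks of bits and one register. -/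
inductive Prog : Type
  | push (k : Fin 4) (f : Option Bool → Bool)
  | pop (k : Fin 4)
  | seq (p q : Prog)
  | ite (c : Option Bool → Bool) (p q : Prog)
  | loop (c : Option Bool → Bool) (p : Prog)

namespace Prog

/-- Big-step semantics with an exact step count. -/
inductive Exec : Prog → Option Bool × Stacks → Option Bool × Stacks → ℕ → Prop
  | push (k f v S) : Exec (push k f) (v, S) (v, Function.update S k (f v :: S k)) 1
  | pop (k v S) : Exec (pop k) (v, S) ((S k).head?, Function.update S k (S k).tail) 1
  | seq {p q s s' s'' t t'} : Exec p s s' t → Exec q s' s'' t' → Exec (seq p q) s s'' (t + t')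
  | iteT {c p q v S s' t} : c v = true → Exec p (v, S) s' t → Exec (ite c p q) (v, S) s' (1 + t)
  | iteF {c p q v S s' t} : c v = false → Exec q (v, S) s' t → Exec (ite c p q) (v, S) s' (1 + t)
  | loopF {c p v S} : c v = false → Exec (loop c p) (v, S) (v, S) 1
  | loopT {c p v S s' s'' t t'} : c v = true → Exec p (v, S) s' t → Exec (loop c p) s' s'' t' →
      Exec (loop c p) (v, S) s'' (1 + t + t')

/-- The labels of the machine code of a program. -/
def Label : Prog → Type
  | push _ _ => Unit
  | pop _ => Unit
  | seq p q => Label p ⊕ Label q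
  | ite _ p q => Option (Label p ⊕ Label q)
  | loop _ p => Option (Label p)

/-- A program has finitely many labels. -/
@[reducible]
def labelFintype : (p : Prog) → Fintype (Label p)
  | push _ _ => inferInstanceAs (Fintype Unit)
  | pop _ => inferInstanceAs (Fintype Unit)
  | seq p q =>
    let _ := labelFintype p
    let _ := labelFintype q
    inferInstanceAs (Fintype (Label p ⊕ Label q))
  | ite _ p q =>
    let _ := labelFintype p
    let _ := labelFintype q
    inferInstanceAs (Fintype (Option (Label p ⊕ Label q)))
  | loop _ p =>
    let _ := labelFintype p
    inferInstanceAs (Fintype (Option (Label p)))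

/-- The label at which a program starts. -/
def entry : (p : Prog) → Label p
  | push _ _ => ()
  | pop _ => ()
  | seq p _ => Sum.inl (entry p)
  | ite _ _ _ => none
  | loop _ _ => none

open Turing.TM2.Stmt in
/-- The machine code of a program, whose labels are embedded into `Λ` and which leaves to the label
`exit`. -/
def compile {Λ : Type} : (p : Prog) → (Label p → Λ) → (exit : Λ) → Label p →
    Turing.TM2.Stmt (fun _ : Fin 4 => Bool) Λ (Option Bool)
  | push k f, _, exit => fun _ => Turing.TM2.Stmt.push k f (goto fun _ => exit)
  | pop k, _, exit => fun _ => Turing.TM2.Stmt.pop k (fun _ x => x) (goto fun _ => exit)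
  | seq p q, emb, exit => fun l => match l with
    | Sum.inl l => compile p (fun l => emb (Sum.inl l)) (emb (Sum.inr (entry q))) l
    | Sum.inr l => compile q (fun l => emb (Sum.inr l)) exit l
  | ite c p q, emb, exit => fun l => match l with
    | none => branch c (goto fun _ => emb (some (Sum.inl (entry p))))
        (goto fun _ => emb (some (Sum.inr (entry q))))
    | some (Sum.inl l) => compile p (fun l => emb (some (Sum.inl l))) exit l
    | some (Sum.inr l) => compile q (fun l => emb (some (Sum.inr l))) exit l
  | loop c p, emb, exit => fun l => match l with
    | none => branch c (goto fun _ => emb (some (entry p))) (goto fun _ => exit)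
    | some l => compile p (fun l => emb (some l)) (emb none) l

/-- Induction on the derivation; step counts add up as iterates of the step function. The machine
`M` is constrained only on the image of `emb`, so that the statement applies to a subprogram inside
a larger one, with its own exit: the body of a loop exits to the test of the loop. -/
theorem Exec.simulate {p : Prog} {s s' : Option Bool × Stacks} {t : ℕ} (h : Exec p s s' t)
    {Λ : Type} (M : Λ → Turing.TM2.Stmt (fun _ : Fin 4 => Bool) Λ (Option Bool))
    (emb : Label p → Λ) (exit : Λ) (hM : ∀ l, M (emb l) = compile p emb exit l) :
    (flip bind (Turing.TM2.step M))^[t] (some ⟨some (emb (entry p)), s.1, s.2⟩) =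
      some ⟨some exit, s'.1, s'.2⟩ := by
  induction h generalizing exit with
  | push k f v S => simp [flip, Turing.TM2.step, hM, compile, Turing.TM2.stepAux]
  | pop k v S => simp [flip, Turing.TM2.step, hM, compile, Turing.TM2.stepAux]
  | @seq p q s s' s'' t t' h1 h2 ih1 ih2 =>
    rw [add_comm, Function.iterate_add_apply]
    have e1 := ih1 (fun l => emb (Sum.inl l)) (emb (Sum.inr (entry q))) (fun l => hM (Sum.inl l))
    have e2 := ih2 (fun l => emb (Sum.inr l)) exit (fun l => hM (Sum.inr l))
    exact (congrArg _ e1).trans e2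
  | @iteT c p q v S s' t hc h1 ih1 =>
    rw [add_comm, Function.iterate_add_apply]
    have e1 := ih1 (fun l => emb (some (Sum.inl l))) exit (fun l => hM (some (Sum.inl l)))
    rw [← e1]
    congr 1
    have e0 : M (emb (entry (ite c p q))) = Turing.TM2.Stmt.branch c
        (Turing.TM2.Stmt.goto fun _ => emb (some (Sum.inl (entry p))))
        (Turing.TM2.Stmt.goto fun _ => emb (some (Sum.inr (entry q)))) := hM none
    simp [flip, Turing.TM2.step, e0, hc]
  | @iteF c p q v S s' t hc h1 ih1 =>
    rw [add_comm, Function.iterate_add_apply]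
    have e1 := ih1 (fun l => emb (some (Sum.inr l))) exit (fun l => hM (some (Sum.inr l)))
    rw [← e1]
    congr 1
    have e0 : M (emb (entry (ite c p q))) = Turing.TM2.Stmt.branch c
        (Turing.TM2.Stmt.goto fun _ => emb (some (Sum.inl (entry p))))
        (Turing.TM2.Stmt.goto fun _ => emb (some (Sum.inr (entry q)))) := hM none
    simp [flip, Turing.TM2.step, e0, hc]
  | @loopF c p v S hc =>
    have e0 : M (emb (entry (loop c p))) = Turing.TM2.Stmt.branch c
        (Turing.TM2.Stmt.goto fun _ => emb (some (entry p)))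
        (Turing.TM2.Stmt.goto fun _ => exit) := hM none
    simp [flip, Turing.TM2.step, e0, hc]
  | @loopT c p v S s' s'' t t' hc h1 h2 ih1 ih2 =>
    rw [show 1 + t + t' = t' + (t + 1) by ring, Function.iterate_add_apply,
      Function.iterate_add_apply]
    have e1 := ih1 (fun l => emb (some l)) (emb none) (fun l => hM (some l))
    have e2 := ih2 emb exit hM
    rw [← e2]
    congr 1
    refine Eq.trans ?_ e1
    congr 1
    have e0 : M (emb (entry (loop c p))) = Turing.TM2.Stmt.branch c
        (Turing.TM2.Stmt.goto fun _ => emb (some (entry p)))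
        (Turing.TM2.Stmt.goto fun _ => exit) := hM none
    simp [flip, Turing.TM2.step, e0, hc]

/-- The Turing machine of a program: stack `0` is used for the input and for the output. -/
def toFinTM2 (p : Prog) : Turing.FinTM2 where
  K := Fin 4
  k₀ := 0
  k₁ := 0
  Γ _ := Bool
  Λ := Option (Label p)
  main := some (entry p)
  ΛFin := let _ := labelFintype p; inferInstanceAs (Fintype (Option (Label p)))
  σ := Option Bool
  initialState := none
  m
    | none => Turing.TM2.Stmt.load (fun _ => none) Turing.TM2.Stmt.halt
    | some l => compile p some none l

/-- The Turing machine of a program, with its alphabets. -/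
def toMachine (p : Prog) : Turing.TM2ComputableAux Bool Bool where
  tm := toFinTM2 p
  inputAlphabet := Equiv.refl Bool
  outputAlphabet := Equiv.refl Bool

/-- The additional step is the one at the exit label `none`: it resets the register, which
`haltList` requires to be in its initial state, and halts. -/
theorem Exec.answersWithin {p : Prog} {w : List Bool} {r : Bool} {v : Option Bool} {t T : ℕ}
    (h : Exec p (none, ![w, [], [], []]) (v, ![[r], [], [], []]) t) (hT : t + 1 ≤ T) :
    AnswersWithin (toMachine p) w r T := by
  have hsim := h.simulate (toFinTM2 p).m some none (fun l => rfl)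
  have hstk : ∀ (w : List Bool) (k : Fin 4), (if h : k = 0 then w else []) = ![w, [], [], []] k := by
    intro w k
    fin_cases k <;> rfl
  have hinit : Turing.initList (toFinTM2 p) (w.map (toMachine p).inputAlphabet.symm) =
      ⟨some (some (entry p)), none, ![w, [], [], []]⟩ := by
    refine Eq.trans (b := ⟨some (some (entry p)), none, fun k : Fin 4 => if h : k = 0 then w else []⟩)
      ?_ (congrArg _ (funext (hstk w)))
    exact congrArg (Turing.initList (toFinTM2 p)) (List.map_id w)
  have hhalt : Turing.haltList (toFinTM2 p) ([r].map (toMachine p).outputAlphabet.symm) =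
      ⟨none, none, ![[r], [], [], []]⟩ :=
    Eq.trans (b := ⟨none, none, fun k : Fin 4 => if h : k = 0 then [r] else []⟩)
      rfl (congrArg _ (funext (hstk [r])))
  refine ⟨⟨⟨t + 1, ?_⟩, hT⟩⟩
  change (flip bind (Turing.TM2.step (toFinTM2 p).m))^[t + 1]
    (some (Turing.initList (toFinTM2 p) (w.map (toMachine p).inputAlphabet.symm))) =
    some (Turing.haltList (toFinTM2 p) ([r].map (toMachine p).outputAlphabet.symm))
  rw [hinit, hhalt, add_comm, Function.iterate_add_apply]
  refine (congrArg _ hsim).trans ?_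
  rfl

end Prog

/-! ### Time-bounded runs and elementary stack operations -/

namespace Prog

theorem update_vec_zero (a b c d x : List Bool) :
    Function.update (![a, b, c, d] : Stacks) 0 x = ![x, b, c, d] := by
  funext i; fin_cases i <;> rfl

theorem update_vec_one (a b c d x : List Bool) :
    Function.update (![a, b, c, d] : Stacks) 1 x = ![a, x, c, d] := by
  funext i; fin_cases i <;> rfl

theorem update_vec_two (a b c d x : List Bool) :
    Function.update (![a, b, c, d] : Stacks) 2 x = ![a, b, x, d] := by
  funext i; fin_cases i <;> rfl

theorem update_vec_three (a b c d x : List Bool) :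
    Function.update (![a, b, c, d] : Stacks) 3 x = ![a, b, c, x] := by
  funext i; fin_cases i <;> rfl

theorem Exec.push_eq {k f v} {S S' : Stacks} (h : Function.update S k (f v :: S k) = S') :
    Exec (Prog.push k f) (v, S) (v, S') 1 := h ▸ Exec.push k f v S

theorem Exec.pop_eq {k v v'} {S S' : Stacks} (hv : (S k).head? = v')
    (h : Function.update S k (S k).tail = S') :
    Exec (Prog.pop k) (v, S) (v', S') 1 := h ▸ hv ▸ Exec.pop k v S

/-- From the stacks `s`, with any register, the program `p` ends with the stacks `s'` after at most
`T` steps. -/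
def Runs (p : Prog) (s s' : Stacks) (T : ℕ) : Prop :=
  ∀ v, ∃ v' t, t ≤ T ∧ Exec p (v, s) (v', s') t

theorem Runs.mono {p s s' T T'} (h : Runs p s s' T) (hT : T ≤ T') : Runs p s s' T' := fun v =>
  let ⟨v', t, ht, he⟩ := h v
  ⟨v', t, ht.trans hT, he⟩

theorem Runs.seq {p q s s' s'' T T'} (h : Runs p s s' T) (h' : Runs q s' s'' T') :
    Runs (p.seq q) s s'' (T + T') := fun v =>
  let ⟨v', t, ht, he⟩ := h v
  let ⟨v'', t', ht', he'⟩ := h' v'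
  ⟨v'', t + t', add_le_add ht ht', he.seq he'⟩

/-- Push the bit `b` on the stack `k`. -/
def put (k : Fin 4) (b : Bool) : Prog := push k fun _ => b

theorem runs_put {k b} {S S' : Stacks} (h : Function.update S k (b :: S k) = S') :
    Runs (put k b) S S' 1 := fun v => ⟨v, 1, le_rfl, Exec.push_eq h⟩

theorem runs_pop {k} {S S' : Stacks} (h : Function.update S k (S k).tail = S') :
    Runs (pop k) S S' 1 := fun _ => ⟨_, 1, le_rfl, Exec.pop_eq rfl h⟩

/-- Empty the stack `i`, executing `p` for every symbol. -/
def drain (i : Fin 4) (p : Prog) : Prog :=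
  seq (pop i) (loop Option.isSome (seq p (pop i)))

/-- If `p` transforms the stacks along the sequence `F` when it is given the symbols of `l`, then so
does `drain`. -/
theorem runs_drain {i : Fin 4} {p : Prog} {n : ℕ} (l : List Bool) (F : List Bool → Stacks)
    (hF : ∀ l₁ a l₂, l = l₁ ++ a :: l₂ → ∃ v S' t, t ≤ n ∧
      Exec p (some a, Function.update (F l₁) i l₂) (v, S') t ∧
      Function.update (F (l₁ ++ [a])) i l₂ = S') :
    Runs (drain i p) (Function.update (F []) i l) (Function.update (F l) i [])
      ((n + 2) * l.length + 2) := by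
  intro v
  -- At the test of the loop the next symbol is already in the register, so the remaining symbols
  -- `l₂` are split into `l₂.head?` and `l₂.tail`. Popping the empty stack yields `none` and ends
  -- the loop.
  suffices H : ∀ l₂ l₁, l = l₁ ++ l₂ → ∃ t, t ≤ (n + 2) * l₂.length + 1 ∧
      Exec (loop Option.isSome (seq p (pop i))) (l₂.head?, Function.update (F l₁) i l₂.tail)
        (none, Function.update (F l) i []) t by
    obtain ⟨t, ht, he⟩ := H l [] rfl
    refine ⟨none, 1 + t, by omega, ?_⟩
    refine Exec.seq ?_ he
    exact Exec.pop_eq (by simp) (by simp)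
  intro l₂
  induction l₂ with
  | nil =>
    intro l₁ h
    rw [List.append_nil] at h
    subst h
    exact ⟨1, by simp, Exec.loopF rfl⟩
  | cons a l₂ ih =>
    intro l₁ h
    obtain ⟨v, S', m, hm, he, hS'⟩ := hF l₁ a l₂ h
    obtain ⟨t, ht, he'⟩ := ih (l₁ ++ [a]) (by simp [h])
    refine ⟨1 + (m + 1) + t, ?_, Exec.loopT rfl (Exec.seq he ?_) he'⟩
    · rw [List.length_cons]; linarith
    · exact Exec.pop_eq (by simp [← hS']) (by simp [← hS'])

/-- Move the stack `i` to the stack `j`, reversing it. -/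
def pour (i j : Fin 4) : Prog := drain i (push j (·.getD false))

theorem runs_pour_one_zero (l a c d : List Bool) :
    Runs (pour 1 0) ![a, l, c, d] ![l.reverse ++ a, [], c, d] (3 * l.length + 2) := by
  have := runs_drain (i := 1) (p := push 0 (·.getD false)) (n := 1) l
    (fun l => ![l.reverse ++ a, [], c, d])
    (fun l₁ x l₂ _ => ⟨_, _, _, le_rfl, Exec.push_eq rfl, by simp [update_vec_zero, update_vec_one]⟩)
  simpa [update_vec_one, pour] using this

theorem runs_pour_one_two (l a c d : List Bool) :
    Runs (pour 1 2) ![a, l, c, d] ![a, [], l.reverse ++ c, d] (3 * l.length + 2) := by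
  have := runs_drain (i := 1) (p := push 2 (·.getD false)) (n := 1) l
    (fun l => ![a, [], l.reverse ++ c, d])
    (fun l₁ x l₂ _ => ⟨_, _, _, le_rfl, Exec.push_eq rfl, by simp [update_vec_two, update_vec_one]⟩)
  simpa [update_vec_one, pour] using this

theorem runs_pour_two_three (l a b d : List Bool) :
    Runs (pour 2 3) ![a, b, l, d] ![a, b, [], l.reverse ++ d] (3 * l.length + 2) := by
  have := runs_drain (i := 2) (p := push 3 (·.getD false)) (n := 1) l
    (fun l => ![a, b, [], l.reverse ++ d])
    (fun l₁ x l₂ _ => ⟨_, _, _, le_rfl, Exec.push_eq rfl, by simp [update_vec_two, update_vec_three]⟩)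
  simpa [update_vec_two, pour] using this

theorem runs_pour_three_zero (l a b c : List Bool) :
    Runs (pour 3 0) ![a, b, c, l] ![l.reverse ++ a, b, c, []] (3 * l.length + 2) := by
  have := runs_drain (i := 3) (p := push 0 (·.getD false)) (n := 1) l
    (fun l => ![l.reverse ++ a, b, c, []])
    (fun l₁ x l₂ _ => ⟨_, _, _, le_rfl, Exec.push_eq rfl, by simp [update_vec_zero, update_vec_three]⟩)
  simpa [update_vec_three, pour] using this

theorem runs_pour_zero_one (l b c d : List Bool) :
    Runs (pour 0 1) ![l, b, c, d] ![[], l.reverse ++ b, c, d] (3 * l.length + 2) := by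
  have := runs_drain (i := 0) (p := push 1 (·.getD false)) (n := 1) l
    (fun l => ![[], l.reverse ++ b, c, d])
    (fun l₁ x l₂ _ => ⟨_, _, _, le_rfl, Exec.push_eq rfl, by simp [update_vec_zero, update_vec_one]⟩)
  simpa [update_vec_zero, pour] using this

/-- Move the stack `1` to both stacks `0` and `2`, reversing it. -/
def pourTwice : Prog := drain 1 (seq (push 0 (·.getD false)) (push 2 (·.getD false)))

theorem runs_pourTwice (l a c d : List Bool) :
    Runs pourTwice ![a, l, c, d] ![l.reverse ++ a, [], l.reverse ++ c, d] (4 * l.length + 2) := by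
  have := runs_drain (i := 1)
    (p := seq (push 0 (·.getD false)) (push 2 (·.getD false))) (n := 2) l
    (fun l => ![l.reverse ++ a, [], l.reverse ++ c, d])
    (fun l₁ x l₂ _ => ⟨_, _, _, le_rfl, Exec.seq (Exec.push_eq rfl) (Exec.push_eq rfl),
      by simp [update_vec_zero, update_vec_one, update_vec_two]⟩)
  simpa [update_vec_one, pourTwice] using this

/-- Empty the stack `i`. -/
def clear (i : Fin 4) : Prog := seq (pop i) (loop Option.isSome (pop i))

theorem runs_clear_one (l a c d : List Bool) :
    Runs (clear 1) ![a, l, c, d] ![a, [], c, d] (2 * l.length + 2) := by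
  intro v
  suffices H : ∀ l : List Bool, ∃ t, t ≤ 2 * l.length + 1 ∧
      Exec (loop Option.isSome (pop 1)) (l.head?, ![a, l.tail, c, d]) (none, ![a, [], c, d]) t by
    obtain ⟨t, ht, he⟩ := H l
    exact ⟨none, 1 + t, by omega, Exec.seq (Exec.pop_eq rfl (update_vec_one ..)) he⟩
  intro l
  induction l with
  | nil => exact ⟨1, by simp, Exec.loopF rfl⟩
  | cons x l ih =>
    obtain ⟨t, ht, he⟩ := ih
    refine ⟨1 + 1 + t, by simp; omega,
      Exec.loopT rfl (Exec.pop_eq (by simp) (by simp [update_vec_one])) he⟩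

end Prog

/-! ### Binary trees on a stack -/

/-- Binary trees, the data of the functions below. -/
inductive BinTree : Type
  | leaf
  | node (l r : BinTree)

namespace BinTree

/-- The Polish notation of a tree. -/
def code : BinTree → List Bool
  | leaf => [false]
  | node l r => true :: (code l ++ code r)

/-- The length of the code of a tree. -/
def size (x : BinTree) : ℕ := x.code.length

@[simp] theorem size_leaf : leaf.size = 1 := rfl

@[simp] theorem size_node (l r : BinTree) : (node l r).size = l.size + r.size + 1 := by
  simp [size, code]

theorem size_pos (x : BinTree) : 0 < x.size := by cases x <;> simp

end BinTree

/-! ### Programs that manipulate trees on the stack 0 -/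

namespace Prog

open BinTree

/-- Move the tree on the stack `0` to the stack `1`, reversing its code. The stack `3` counts the
subtrees that are still to be moved. -/
def moveTree : Prog :=
  seq (put 3 true) <| seq (pop 3) <| loop Option.isSome <|
    seq (pop 0) <| seq (push 1 (·.getD false)) <|
    seq (ite (· = some true) (seq (put 3 true) (put 3 true)) (put 3 false))
      (ite (· = some true) (pop 3) (seq (pop 3) (pop 3)))

theorem runs_moveTree (x : BinTree) (r b c : List Bool) :
    Runs moveTree ![x.code ++ r, b, c, []] ![r, x.code.reverse ++ b, c, []]
      (9 * x.size + 3) := by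
  intro v
  -- Continuation form: any run of the loop from the state after `x` has been moved extends to a run
  -- from the state before. The node case can thus chain the right and the left subtree. Being in
  -- the loop accounts for one pending subtree, and `d` holds the others.
  suffices H : ∀ (x : BinTree) (r b d : List Bool) (s' : Option Bool × Stacks) (t' : ℕ),
      Exec (loop Option.isSome <|
        seq (pop 0) <| seq (push 1 (·.getD false)) <|
        seq (ite (· = some true) (seq (put 3 true) (put 3 true)) (put 3 false))
          (ite (· = some true) (pop 3) (seq (pop 3) (pop 3))))
        (d.head?, ![r, x.code.reverse ++ b, c, d.tail]) s' t' →
      ∃ t, t ≤ t' + 9 * x.size ∧ Exec (loop Option.isSome <|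
        seq (pop 0) <| seq (push 1 (·.getD false)) <|
        seq (ite (· = some true) (seq (put 3 true) (put 3 true)) (put 3 false))
          (ite (· = some true) (pop 3) (seq (pop 3) (pop 3))))
        (some true, ![x.code ++ r, b, c, d]) s' t by
    obtain ⟨t, ht, he⟩ := H x r b [] (none, ![r, x.code.reverse ++ b, c, []]) 1
      (Exec.loopF rfl)
    exact ⟨none, 1 + (1 + t), by omega, Exec.seq (Exec.push_eq (update_vec_three ..))
      (Exec.seq (Exec.pop_eq (by simp) (by simp [update_vec_three])) he)⟩
  intro x
  induction x with
  | leaf =>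
    intro r b d s' t' h
    refine ⟨1 + (1 + (1 + ((1 + 1) + (1 + (1 + 1))))) + t', by simp; omega, Exec.loopT rfl ?_ h⟩
    refine Exec.seq (Exec.pop_eq rfl (by simp [update_vec_zero, code]; rfl)) ?_
    refine Exec.seq (Exec.push_eq (by simp [update_vec_one]; rfl)) ?_
    refine Exec.seq (Exec.iteF (by simp [code]) (Exec.push_eq (update_vec_three ..))) ?_
    refine Exec.iteF (by simp [code]) ?_
    exact Exec.seq (Exec.pop_eq rfl (by simp [update_vec_three]; rfl))
      (Exec.pop_eq (by simp) (by simp [update_vec_three, code]))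
  | node x y ihx ihy =>
    intro r b d s' t' h
    obtain ⟨t₁, ht₁, h₁⟩ := ihy r (x.code.reverse ++ true :: b) d s' t' (by simpa [code] using h)
    obtain ⟨t₂, ht₂, h₂⟩ := ihx (y.code ++ r) (true :: b) (true :: d) s' t₁ h₁
    refine ⟨1 + (1 + (1 + ((1 + (1 + 1)) + (1 + 1)))) + t₂, by simp; omega, Exec.loopT rfl ?_ h₂⟩
    refine Exec.seq (Exec.pop_eq rfl (by simp [update_vec_zero, code]; rfl)) ?_
    refine Exec.seq (Exec.push_eq (by simp [update_vec_one]; rfl)) ?_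
    refine Exec.seq (Exec.iteT (by simp [code]) (Exec.seq (Exec.push_eq (update_vec_three ..))
      (Exec.push_eq (update_vec_three ..)))) ?_
    exact Exec.iteT (by simp [code]) (Exec.pop_eq rfl (by simp [update_vec_three, code]))

/-- On the stack `0`, the program `p` replaces the tree `x` by the tree `y` within `T` steps, and
the other stacks are used as scratch space only. -/
def Maps (p : Prog) (x y : BinTree) (T : ℕ) : Prop :=
  ∀ r, Runs p ![x.code ++ r, [], [], []] ![y.code ++ r, [], [], []] T

theorem Maps.mono {p x y T T'} (h : Maps p x y T) (hT : T ≤ T') : Maps p x y T' :=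
  fun r => (h r).mono hT

theorem Maps.comp {p q x y z T T'} (h : Maps p x y T) (h' : Maps q y z T') :
    Maps (p.seq q) x z (T + T') := fun r => (h r).seq (h' r)

/-- Remove the tree on the stack `0`. -/
def drop : Prog := seq moveTree (clear 1)

theorem runs_drop (x : BinTree) (r : List Bool) :
    Runs drop ![x.code ++ r, [], [], []] ![r, [], [], []] (11 * x.size + 5) :=
  ((runs_moveTree x r [] []).seq (runs_clear_one _ _ _ _)).mono (by simp [size]; omega)

/-- Duplicate the tree on the stack `0`. -/
def dup : Prog := seq moveTree <| seq pourTwice <| seq (pour 2 3) (pour 3 0)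

theorem runs_dup (x : BinTree) (r : List Bool) :
    Runs dup ![x.code ++ r, [], [], []] ![x.code ++ (x.code ++ r), [], [], []]
      (19 * x.size + 9) := by
  have h := (runs_moveTree x r [] []).seq ((runs_pourTwice _ _ _ _).seq
    ((runs_pour_two_three _ _ _ _).seq (runs_pour_three_zero _ _ _ _)))
  simp only [List.append_nil, List.reverse_reverse, List.length_reverse] at h
  exact h.mono (by simp only [size]; omega)

/-- Exchange the two trees on the stack `0`. -/
def swap : Prog :=
  seq moveTree <| seq (pour 1 2) <| seq moveTree <| seq (pour 2 3) <| seq (pour 3 0) (pour 1 0)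

theorem runs_swap (x y : BinTree) (r : List Bool) :
    Runs swap ![x.code ++ (y.code ++ r), [], [], []] ![y.code ++ (x.code ++ r), [], [], []]
      (18 * x.size + 12 * y.size + 14) := by
  have h := (runs_moveTree x (y.code ++ r) [] []).seq ((runs_pour_one_two _ _ _ _).seq
    ((runs_moveTree y r _ _).seq ((runs_pour_two_three _ _ _ _).seq
    ((runs_pour_three_zero _ _ _ _).seq (runs_pour_one_zero _ _ _ _)))))
  simp only [List.append_nil, List.reverse_reverse, List.length_reverse] at h
  exact h.mono (by simp only [size]; omega)

/-- The right subtree. -/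
def right : Prog := seq (pop 0) drop

theorem maps_right (x y : BinTree) : Maps right (node x y) y (11 * x.size + 6) := fun r =>
  ((runs_pop (by simp [code, update_vec_zero])).seq (runs_drop x (y.code ++ r))).mono (by omega)

/-- The left subtree. -/
def left : Prog := seq (pop 0) (seq swap drop)

theorem maps_left (x y : BinTree) : Maps left (node x y) x (18 * x.size + 23 * y.size + 20) :=
  fun r => ((runs_pop (by simp [code, update_vec_zero])).seq
    ((runs_swap x y r).seq (runs_drop y (x.code ++ r)))).mono (by omega)

/-- Replace a tree by a leaf. -/
def toLeaf : Prog := seq drop (put 0 false)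

theorem maps_toLeaf (x : BinTree) : Maps toLeaf x leaf (11 * x.size + 6) := fun r =>
  ((runs_drop x r).seq (runs_put (by simp [code, update_vec_zero]))).mono (by omega)

/-- Do nothing. -/
def skip : Prog := seq (put 0 false) (pop 0)

theorem maps_skip (x : BinTree) : Maps skip x x 2 := fun _ =>
  (runs_put (S' := ![false :: (x.code ++ _), [], [], []]) (update_vec_zero ..)).seq
    (runs_pop (by simp [update_vec_zero]))

/-- The tree whose subtrees are computed by `p` and `q`. -/
def pair (p q : Prog) : Prog :=
  seq dup <| seq p <| seq swap <| seq q <| seq swap (put 0 true)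

theorem Maps.pair {p q : Prog} {x y z : BinTree} {T T' : ℕ} (hp : Maps p x y T)
    (hq : Maps q x z T') :
    Maps (pair p q) x (node y z) (T + T' + 31 * x.size + 30 * y.size + 18 * z.size + 38) :=
  fun r => ((runs_dup x r).seq ((hp _).seq ((runs_swap y x r).seq ((hq _).seq
    ((runs_swap z y r).seq (runs_put (by simp [code, update_vec_zero]))))))).mono (by omega)

/-- Load the first symbol of the left subtree into the register. -/
def testLeft : Prog :=
  seq (pop 0) <| seq (pop 0) <| seq (push 0 (·.getD false)) (put 0 true)

theorem exec_testLeft_leaf (v : Option Bool) (y : BinTree) (r : List Bool) :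
    Exec testLeft (v, ![(node leaf y).code ++ r, [], [], []])
      (some false, ![(node leaf y).code ++ r, [], [], []]) 4 :=
  Exec.seq (t := 1) (t' := 3) (Exec.pop_eq rfl (update_vec_zero ..))
    (Exec.seq (t := 1) (t' := 2) (Exec.pop_eq rfl (update_vec_zero ..))
    (Exec.seq (Exec.push_eq (update_vec_zero ..)) (Exec.push_eq (update_vec_zero ..))))

theorem exec_testLeft_node (v : Option Bool) (x x' y : BinTree) (r : List Bool) :
    Exec testLeft (v, ![(node (node x x') y).code ++ r, [], [], []])
      (some true, ![(node (node x x') y).code ++ r, [], [], []]) 4 :=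
  Exec.seq (t := 1) (t' := 3) (Exec.pop_eq rfl (update_vec_zero ..))
    (Exec.seq (t := 1) (t' := 2) (Exec.pop_eq rfl (update_vec_zero ..))
    (Exec.seq (Exec.push_eq (update_vec_zero ..)) (Exec.push_eq (update_vec_zero ..))))

/-- Remove the left subtree; then execute `p` if it was not a leaf, and `q` if it was one. -/
def iteLeft (p q : Prog) : Prog := seq testLeft (ite (· = some true) (seq right p) (seq right q))

theorem Maps.iteLeft_leaf {p q : Prog} {y z : BinTree} {T : ℕ} (h : Maps q y z T) :
    Maps (iteLeft p q) (node leaf y) z (T + 22) := fun r v => by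
  obtain ⟨v', t, ht, he⟩ := ((maps_right leaf y).comp h) r (some false)
  exact ⟨v', 4 + (1 + t), by rw [size_leaf] at ht; omega,
    Exec.seq (exec_testLeft_leaf ..) (Exec.iteF (by simp) he)⟩

theorem Maps.iteLeft_node {p q : Prog} {x x' y z : BinTree} {T : ℕ} (h : Maps p y z T) :
    Maps (iteLeft p q) (node (node x x') y) z (T + 11 * (node x x').size + 11) := fun r v => by
  obtain ⟨v', t, ht, he⟩ := ((maps_right (node x x') y).comp h) r (some true)
  exact ⟨v', 4 + (1 + t), by omega,
    Exec.seq (exec_testLeft_node ..) (Exec.iteT (by simp) he)⟩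

/-- Execute `p` until the left subtree is a leaf. -/
def whileLeft (p : Prog) : Prog := seq testLeft (loop (· = some true) (seq p testLeft))

theorem Maps.whileLeft_leaf (p : Prog) (y : BinTree) :
    Maps (whileLeft p) (node leaf y) (node leaf y) 5 := fun r v =>
  ⟨_, _, le_rfl, Exec.seq (exec_testLeft_leaf ..) (Exec.loopF (by simp))⟩

theorem Maps.whileLeft_node {p : Prog} {x x' y h y' z : BinTree} {T T' : ℕ}
    (hp : Maps p (node (node x x') y) (node h y') T)
    (hw : Maps (whileLeft p) (node h y') z T') :
    Maps (whileLeft p) (node (node x x') y) z (T + T' + 5) := fun r v => by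
  obtain ⟨v₁, t₁, ht₁, he₁⟩ := hp r (some true)
  obtain ⟨v₂, t₂, ht₂, he₂⟩ := hw r v₁
  -- The run `he₂` begins with `testLeft`; that part becomes the end of the first iteration, and the
  -- rest is the remainder of the loop.
  cases he₂ with
  | @seq _ _ _ s' _ t t' h₁ h₂ =>
    refine ⟨v₂, 4 + (1 + (t₁ + t) + t'), by omega, Exec.seq (exec_testLeft_node ..)
      (Exec.loopT (by simp) (Exec.seq he₁ h₁) h₂)⟩

/-- The tree that represents a bit. -/
def _root_.BinTree.ofBool (b : Bool) : BinTree := if b then node leaf leaf else leaf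

/-- The tree that represents a list. -/
def _root_.BinTree.ofList : List BinTree → BinTree
  | [] => leaf
  | x :: l => node x (BinTree.ofList l)

/-- Replace a word by its tree. -/
def readWord : Prog :=
  seq (pour 0 1) <| seq (put 0 false) <| drain 1 <|
    ite (· = some true) (seq (put 0 false) <| seq (put 0 false) <| seq (put 0 true) (put 0 true))
      (seq (put 0 false) (put 0 true))

theorem runs_readWord (w : List Bool) :
    Runs readWord ![w, [], [], []] ![(BinTree.ofList (w.map BinTree.ofBool)).code, [], [], []]
      (10 * w.length + 5) := by
  have h₁ := runs_pour_zero_one w [] [] []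
  have h₂ := runs_drain (i := 1) (n := 5) (p := ite (· = some true)
    (seq (put 0 false) <| seq (put 0 false) <| seq (put 0 true) (put 0 true))
      (seq (put 0 false) (put 0 true))) w.reverse
    (fun l => ![(BinTree.ofList (l.reverse.map BinTree.ofBool)).code, [], [], []]) (by
    intro l₁ a l₂ _
    simp only [update_vec_one]
    cases a with
    | true => exact ⟨_, _, _, le_rfl, Exec.iteT (by simp) (Exec.seq (Exec.push_eq (update_vec_zero ..))
        (Exec.seq (Exec.push_eq (update_vec_zero ..)) (Exec.seq (Exec.push_eq (update_vec_zero ..))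
        (Exec.push_eq (update_vec_zero ..))))), by simp [code, BinTree.ofList, BinTree.ofBool]⟩
    | false => exact ⟨_, _, _, by simp, Exec.iteF (by simp) (Exec.seq (Exec.push_eq (update_vec_zero ..))
        (Exec.push_eq (update_vec_zero ..))), by simp [code, BinTree.ofList, BinTree.ofBool]⟩)
  refine (h₁.seq (Runs.seq (T := 1) (s' := ![[false], w.reverse, [], []])
    (runs_put (by simp [update_vec_zero])) (T' := 7 * w.length + 2) ?_)).mono (by omega)
  simpa [update_vec_one, BinTree.ofList, code] using h₂

/-- Replace the tree of a bit by the bit. -/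
def writeBool : Prog :=
  seq (pop 0) (ite (· = some true) (seq (pop 0) (seq (pop 0) (put 0 true))) (put 0 false))

theorem runs_writeBool (b : Bool) :
    Runs writeBool ![(BinTree.ofBool b).code, [], [], []] ![[b], [], [], []] 5 := fun v => by
  cases b with
  | true => exact ⟨_, 1 + (1 + (1 + (1 + 1))), le_rfl, Exec.seq (Exec.pop_eq rfl (update_vec_zero ..))
      (Exec.iteT (by simp [code, BinTree.ofBool]) (Exec.seq (Exec.pop_eq rfl (update_vec_zero ..))
      (Exec.seq (Exec.pop_eq rfl (update_vec_zero ..)) (Exec.push_eq (update_vec_zero ..)))))⟩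
  | false => exact ⟨_, 1 + (1 + 1), by omega, Exec.seq (Exec.pop_eq rfl (update_vec_zero ..))
      (Exec.iteF (by simp [code, BinTree.ofBool]) (Exec.push_eq (update_vec_zero ..)))⟩

/-- A program that computes a decision on the trees of words yields a machine that answers. -/
theorem Maps.answersWithin {p : Prog} {w : List Bool} {b : Bool} {T T' : ℕ}
    (h : Maps p (BinTree.ofList (w.map BinTree.ofBool)) (BinTree.ofBool b) T)
    (hT : T + 10 * w.length + 11 ≤ T') :
    AnswersWithin (toMachine (seq readWord (seq p writeBool))) w b T' := by
  have h' := h []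
  rw [List.append_nil, List.append_nil] at h'
  obtain ⟨v', t, ht, he⟩ := ((runs_readWord w).seq (h'.seq (runs_writeBool b))) none
  exact he.answersWithin (by omega)

end Prog

/-! ### Polynomially bounded functions -/

/-- A monotone function that is bounded by a polynomial. -/
def PolyBdd (p : ℕ → ℕ) : Prop := Monotone p ∧ ∃ c, ∀ n, p n ≤ (n + 2) ^ c

namespace PolyBdd

variable {p q : ℕ → ℕ}

theorem const (a : ℕ) : PolyBdd fun _ => a :=
  ⟨monotone_const, a, fun n => Nat.lt_two_pow_self.le.trans (Nat.pow_le_pow_left (by omega) a)⟩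

theorem id : PolyBdd fun n => n := ⟨monotone_id, 1, fun n => by simp⟩

/-- The base `n + 2` is at least `2`, so the factor `2` is absorbed by one more power, even at `n =
0`. -/
theorem add (hp : PolyBdd p) (hq : PolyBdd q) : PolyBdd fun n => p n + q n := by
  obtain ⟨hp, c, hc⟩ := hp
  obtain ⟨hq, d, hd⟩ := hq
  refine ⟨hp.add hq, c + d + 1, fun n => ?_⟩
  have h1 : (n + 2) ^ c ≤ (n + 2) ^ (c + d) := Nat.pow_le_pow_right (by omega) (by omega)
  have h2 : (n + 2) ^ d ≤ (n + 2) ^ (c + d) := Nat.pow_le_pow_right (by omega) (by omega)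
  calc p n + q n ≤ (n + 2) ^ (c + d) * 2 := by linarith [hc n, hd n]
    _ ≤ (n + 2) ^ (c + d + 1) := by rw [pow_succ]; exact Nat.mul_le_mul_left _ (by omega)

theorem mul (hp : PolyBdd p) (hq : PolyBdd q) : PolyBdd fun n => p n * q n := by
  obtain ⟨hp, c, hc⟩ := hp
  obtain ⟨hq, d, hd⟩ := hq
  refine ⟨fun a b h => Nat.mul_le_mul (hp h) (hq h), c + d, fun n => ?_⟩
  rw [pow_add]
  exact Nat.mul_le_mul (hc n) (hd n)

theorem comp (hp : PolyBdd p) (hq : PolyBdd q) : PolyBdd fun n => p (q n) := by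
  obtain ⟨hp, c, hc⟩ := hp
  obtain ⟨hq, d, hd⟩ := hq
  refine ⟨hp.comp hq, (d + 2) * c, fun n => (hc _).trans ?_⟩
  rw [pow_mul]
  refine Nat.pow_le_pow_left ?_ c
  have : 1 ≤ (n + 2) ^ d := Nat.one_le_pow _ _ (by omega)
  calc q n + 2 ≤ (n + 2) ^ d * 3 := by linarith [hd n]
    _ ≤ (n + 2) ^ (d + 2) := by
      rw [pow_add]
      exact Nat.mul_le_mul_left _ (by nlinarith [Nat.zero_le n])

theorem mono (hp : PolyBdd p) {a b : ℕ} (h : a ≤ b) : p a ≤ p b := hp.1 h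

end PolyBdd

/-! ### Functions that are computable in polynomial time -/

/-- A representation by binary trees. -/
class Enc (A : Type) where
  /-- The tree that represents an object. -/
  enc : A → BinTree

/-- The size of the tree that represents an object. -/
def esize {A : Type} [Enc A] (a : A) : ℕ := (Enc.enc a).size

/-- The tree of a natural number in unary. -/
def BinTree.ofNat : ℕ → BinTree
  | 0 => leaf
  | n + 1 => node leaf (ofNat n)

/-- The trees carry no type information: a nonempty list has the tree of the pair of its head and
tail, and a number that of a list of units. Conversions between these cost nothing
(`PolyTime.of_enc_eq`). -/
instance : Enc Unit := ⟨fun _ => .leaf⟩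
instance : Enc Bool := ⟨BinTree.ofBool⟩
instance : Enc ℕ := ⟨BinTree.ofNat⟩
instance {A B : Type} [Enc A] [Enc B] : Enc (A × B) := ⟨fun p => .node (Enc.enc p.1) (Enc.enc p.2)⟩
instance {A : Type} [Enc A] : Enc (List A) := ⟨fun l => BinTree.ofList (l.map Enc.enc)⟩

section esize

variable {A B : Type} [Enc A] [Enc B]

theorem esize_pos (a : A) : 0 < esize a := BinTree.size_pos _

theorem esize_bool_le (b : Bool) : esize b ≤ 3 := by cases b <;> decide

@[simp] theorem esize_prod (p : A × B) : esize p = esize p.1 + esize p.2 + 1 :=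
  BinTree.size_node _ _

@[simp] theorem esize_nat (n : ℕ) : esize n = 2 * n + 1 := by
  induction n with
  | zero => rfl
  | succ n ih =>
    change (BinTree.node .leaf (BinTree.ofNat n)).size = _
    rw [BinTree.size_node, show (BinTree.ofNat n).size = _ from ih, BinTree.size_leaf]
    ring

@[simp] theorem esize_nil : esize ([] : List A) = 1 := rfl

@[simp] theorem esize_cons (a : A) (l : List A) : esize (a :: l) = esize a + esize l + 1 :=
  BinTree.size_node _ _

theorem esize_append (l l' : List A) : esize (l ++ l') + 1 = esize l + esize l' := by
  induction l with
  | nil => simp; omega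
  | cons a l ih => simp; omega

theorem length_lt_esize (l : List A) : l.length < esize l := by
  induction l with
  | nil => simp
  | cons a l ih => simp; omega

theorem esize_le_of_mem {a : A} {l : List A} (h : a ∈ l) : esize a ≤ esize l := by
  induction l with
  | nil => simp at h
  | cons b l ih =>
    rw [esize_cons]
    rcases List.mem_cons.1 h with rfl | h
    · omega
    · have := ih h; omega

theorem esize_le_of_sublist {l l' : List A} (h : l.Sublist l') : esize l ≤ esize l' := by
  induction h with
  | slnil => rfl
  | cons a _ ih => rw [esize_cons]; omega
  | cons_cons a _ ih => simp only [esize_cons]; omega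

theorem esize_le_mul {l : List A} {n : ℕ} (h : ∀ a ∈ l, esize a ≤ n) :
    esize l ≤ l.length * (n + 1) + 1 := by
  induction l with
  | nil => simp
  | cons a l ih =>
    have h1 := h a (by simp)
    have h2 := ih fun b hb => h b (by simp [hb])
    rw [esize_cons, List.length_cons, Nat.add_mul]
    omega

end esize

/-- `f` is computable in time polynomial in the size of the argument and in the measure `μ`. -/
def PolyTimeIn {A B : Type} [Enc A] [Enc B] (μ : A → ℕ) (f : A → B) : Prop :=
  ∃ p q, PolyBdd q ∧ ∀ a, esize (f a) ≤ q (esize a + μ a) ∧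
    Prog.Maps p (Enc.enc a) (Enc.enc (f a)) (q (esize a + μ a))

/-- `f` is computable in polynomial time. -/
@[fun_prop]
def PolyTime {A B : Type} [Enc A] [Enc B] (f : A → B) : Prop := PolyTimeIn (fun _ => 0) f

/-! ### Closure under composition, pairing and case distinction -/

section closure

variable {A B C X : Type} [Enc A] [Enc B] [Enc C] [Enc X]

theorem polyTime_iff {f : A → B} : PolyTime f ↔ ∃ p q, PolyBdd q ∧ ∀ a, esize (f a) ≤ q (esize a) ∧
    Prog.Maps p (Enc.enc a) (Enc.enc (f a)) (q (esize a)) := Iff.rfl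

theorem PolyTime.polyTimeIn {f : A → B} (h : PolyTime f) (μ : A → ℕ) : PolyTimeIn μ f := by
  obtain ⟨p, q, hq, h⟩ := h
  exact ⟨p, q, hq, fun a => ⟨(h a).1.trans (hq.mono (Nat.le_add_right _ _)),
    (h a).2.mono (hq.mono (Nat.le_add_right _ _))⟩⟩

/-- The measure of the intermediate value must be controlled by the input; this is how the measure
given by the number of choices is later exchanged for one that depends on the parameter. -/
theorem PolyTimeIn.comp {μ : A → ℕ} {ν : B → ℕ} {g : B → C} {f : A → B} (hg : PolyTimeIn ν g)
    (hf : PolyTimeIn μ f) {r : ℕ → ℕ} (hr : PolyBdd r) (h : ∀ a, ν (f a) ≤ r (esize a + μ a)) :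
    PolyTimeIn μ fun a => g (f a) := by
  obtain ⟨p, q, hq, hp⟩ := hg
  obtain ⟨p', q', hq', hp'⟩ := hf
  refine ⟨p'.seq p, fun n => q' n + q (q' n + r n), hq'.add (hq.comp (hq'.add hr)), fun a => ?_⟩
  have h1 : q (esize (f a) + ν (f a)) ≤ q (q' (esize a + μ a) + r (esize a + μ a)) :=
    hq.mono (add_le_add (hp' a).1 (h a))
  exact ⟨((hp _).1.trans h1).trans (Nat.le_add_left _ _),
    ((hp' a).2.comp (hp (f a)).2).mono (Nat.add_le_add_left h1 _)⟩

theorem PolyTime.comp_in {μ : A → ℕ} {g : B → C} {f : A → B} (hg : PolyTime g)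
    (hf : PolyTimeIn μ f) : PolyTimeIn μ fun a => g (f a) :=
  PolyTimeIn.comp hg hf (PolyBdd.const 0) fun _ => le_rfl

@[fun_prop]
theorem PolyTime.comp {g : B → C} {f : A → B} (hg : PolyTime g) (hf : PolyTime f) :
    PolyTime fun a => g (f a) := hg.comp_in hf

/-- Functions that do not change the representation. -/
theorem PolyTime.of_enc_eq {f : A → B} (h : ∀ a, Enc.enc (f a) = Enc.enc a) : PolyTime f :=
  polyTime_iff.2 ⟨Prog.skip, fun n => n + 2, PolyBdd.id.add (PolyBdd.const 2), fun a =>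
    ⟨by unfold esize; rw [h]; dsimp only; omega,
      by rw [h]; exact (Prog.maps_skip _).mono (Nat.le_add_left _ _)⟩⟩

@[fun_prop]
theorem PolyTime.id : PolyTime fun a : A => a := PolyTime.of_enc_eq fun _ => rfl

@[fun_prop]
theorem PolyTime.const (b : B) : PolyTime fun _ : A => b := by
  suffices H : ∀ y : BinTree, ∃ p q, PolyBdd q ∧ ∀ x, y.size ≤ q x.size ∧ Prog.Maps p x y (q x.size) by
    obtain ⟨p, q, hq, h⟩ := H (Enc.enc b)
    exact ⟨p, q, hq, fun a => h (Enc.enc a)⟩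
  intro y
  induction y with
  | leaf =>
    exact ⟨Prog.toLeaf, fun n => 11 * n + 6, ((PolyBdd.const 11).mul PolyBdd.id).add
      (PolyBdd.const 6), fun x => ⟨by simp, Prog.maps_toLeaf x⟩⟩
  | node y z ihy ihz =>
    obtain ⟨p, q, hq, h⟩ := ihy
    obtain ⟨p', q', hq', h'⟩ := ihz
    refine ⟨p.pair p', fun n => q n + q' n + 31 * n + 30 * y.size + 18 * z.size + 38,
      ((((hq.add hq').add ((PolyBdd.const 31).mul PolyBdd.id)).add (PolyBdd.const _)).add
        (PolyBdd.const _)).add (PolyBdd.const _), fun x => ⟨?_, (h x).2.pair (h' x).2⟩⟩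
    rw [BinTree.size_node]
    dsimp only
    omega

theorem PolyTimeIn.prodMk {μ : A → ℕ} {f : A → B} {g : A → C} (hf : PolyTimeIn μ f)
    (hg : PolyTimeIn μ g) : PolyTimeIn μ fun a => (f a, g a) := by
  obtain ⟨p, q, hq, h⟩ := hf
  obtain ⟨p', q', hq', h'⟩ := hg
  refine ⟨p.pair p', fun n => q n + q' n + 31 * n + 30 * q n + 18 * q' n + 38,
    ((((hq.add hq').add ((PolyBdd.const 31).mul PolyBdd.id)).add ((PolyBdd.const 30).mul hq)).add
      ((PolyBdd.const 18).mul hq')).add (PolyBdd.const _), fun a => ⟨?_, ?_⟩⟩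
  · have h1 := (h a).1
    have h2 := (h' a).1
    rw [esize_prod]
    dsimp only
    omega
  · have h1 := (h a).1
    have h2 := (h' a).1
    refine ((h a).2.pair (h' a).2).mono ?_
    change _ + _ + 31 * esize a + 30 * esize (f a) + 18 * esize (g a) + 38 ≤ _
    have : 31 * esize a ≤ 31 * (esize a + μ a) := by omega
    dsimp only
    omega

@[fun_prop]
theorem PolyTime.prodMk {f : A → B} {g : A → C} (hf : PolyTime f) (hg : PolyTime g) :
    PolyTime fun a => (f a, g a) := PolyTimeIn.prodMk hf hg

theorem PolyTime.fst' : PolyTime fun p : A × B => p.1 :=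
  polyTime_iff.2 ⟨Prog.left, fun n => 41 * n + 20, ((PolyBdd.const 41).mul PolyBdd.id).add (PolyBdd.const 20),
    fun p => ⟨by rw [esize_prod]; dsimp only; omega,
      (Prog.maps_left _ _).mono (by rw [esize_prod]; unfold esize; dsimp only; omega)⟩⟩

theorem PolyTime.snd' : PolyTime fun p : A × B => p.2 :=
  polyTime_iff.2 ⟨Prog.right, fun n => 41 * n + 20, ((PolyBdd.const 41).mul PolyBdd.id).add (PolyBdd.const 20),
    fun p => ⟨by rw [esize_prod]; dsimp only; omega,
      (Prog.maps_right _ _).mono (by rw [esize_prod]; unfold esize; dsimp only; omega)⟩⟩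

@[fun_prop]
theorem PolyTime.fst {f : A → B × C} (hf : PolyTime f) : PolyTime fun a => (f a).1 :=
  PolyTime.fst'.comp hf

@[fun_prop]
theorem PolyTime.snd {f : A → B × C} (hf : PolyTime f) : PolyTime fun a => (f a).2 :=
  PolyTime.snd'.comp hf

/-- A case distinction according to whether the tree of a first component is a leaf. -/
theorem PolyTime.iteLeft {g h : B → C} {F : A × B → C} (hg : PolyTime g)
    (hh : PolyTime h) (h0 : ∀ a b, Enc.enc a = .leaf → Enc.enc (F (a, b)) = Enc.enc (h b))
    (h1 : ∀ a b, Enc.enc a ≠ .leaf → Enc.enc (F (a, b)) = Enc.enc (g b)) : PolyTime F := by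
  obtain ⟨p, q, hq, hp⟩ := polyTime_iff.1 hg
  obtain ⟨p', q', hq', hp'⟩ := polyTime_iff.1 hh
  refine polyTime_iff.2 ⟨p.iteLeft p', fun n => q n + q' n + 11 * n + 22,
    ((hq.add hq').add ((PolyBdd.const 11).mul PolyBdd.id)).add (PolyBdd.const 22), ?_⟩
  rintro ⟨a, b⟩
  have e1 : q (esize b) ≤ q (esize (a, b)) := hq.mono (by simp; omega)
  have e2 : q' (esize b) ≤ q' (esize (a, b)) := hq'.mono (by simp; omega)
  have e3 : esize a ≤ esize (a, b) := by simp; omega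
  dsimp only
  cases ha : Enc.enc a with
  | leaf =>
    have h := h0 a b ha
    refine ⟨?_, ?_⟩
    · unfold esize
      rw [h]
      have := (hp' b).1
      unfold esize at *
      omega
    · rw [h]
      change Prog.Maps _ (.node (Enc.enc a) (Enc.enc b)) _ _
      rw [ha]
      exact (Prog.Maps.iteLeft_leaf (hp' b).2).mono (by omega)
  | node x y =>
    have h := h1 a b (by simp [ha])
    refine ⟨?_, ?_⟩
    · unfold esize
      rw [h]
      have := (hp b).1
      unfold esize at *
      omega
    · rw [h]
      change Prog.Maps _ (.node (Enc.enc a) (Enc.enc b)) _ _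
      rw [ha]
      refine (Prog.Maps.iteLeft_node (hp b).2).mono ?_
      rw [← ha]
      change _ + 11 * esize a + _ ≤ _
      omega

end closure

/-! ### Folds, conditionals and Boolean operations -/

section closure

variable {A B C X : Type} [Enc A] [Enc B] [Enc C] [Enc X]

theorem PolyTime.size_bound {f : A → B} (hf : PolyTime f) :
    ∃ q, PolyBdd q ∧ ∀ a, esize (f a) ≤ q (esize a) :=
  let ⟨_, q, hq, h⟩ := polyTime_iff.1 hf
  ⟨q, hq, fun a => (h a).1⟩

theorem PolyTime.size_bound_mem {l : X → List A} {f : X → A → B} (hl : PolyTime l)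
    (hf : PolyTime fun p : X × A => f p.1 p.2) :
    ∃ q, PolyBdd q ∧ ∀ x, ∀ a ∈ l x, esize (f x a) ≤ q (esize x) := by
  obtain ⟨q, hq, h⟩ := hl.size_bound
  obtain ⟨q', hq', h'⟩ := hf.size_bound
  refine ⟨fun n => q' (n + q n + 1), hq'.comp ((PolyBdd.id.add hq).add (PolyBdd.const 1)),
    fun x a ha => (h' (x, a)).trans (hq'.mono ?_)⟩
  have := (esize_le_of_mem ha).trans (h x)
  rw [esize_prod]
  dsimp only
  omega

/-- A fold is computable in polynomial time if the sizes of its states are polynomially bounded. -/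
theorem PolyTimeIn.foldl_of_bound {μ : X → ℕ} {f : X → List A} {g : X → B} {h : X → B → A → B}
    (hf : PolyTimeIn μ f) (hg : PolyTimeIn μ g)
    (hh : PolyTime fun p : X × B × A => h p.1 p.2.1 p.2.2) {q : ℕ → ℕ} (hq : PolyBdd q)
    (hb : ∀ x l, l <+: f x → esize (l.foldl (h x) (g x)) ≤ q (esize x + μ x)) :
    PolyTimeIn μ fun x => (f x).foldl (h x) (g x) := by
  -- The loop state is (remaining list, (argument, accumulator)). While the list is nonempty, its
  -- tree is that of a pair, so the body receives head and tail as components.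
  have hbody : PolyTime fun s : (A × List A) × (X × B) =>
      (s.1.2, (s.2.1, h s.2.1 s.2.2 s.1.1)) := by
    have : PolyTime fun s : (A × List A) × (X × B) => h s.2.1 s.2.2 s.1.1 :=
      hh.comp (f := fun s : (A × List A) × (X × B) => (s.2.1, s.2.2, s.1.1)) (by fun_prop)
    fun_prop
  obtain ⟨p₀, q₀, hq₀, h₀⟩ := hf.prodMk ((PolyTime.id.polyTimeIn μ).prodMk hg)
  obtain ⟨p₁, q₁, hq₁, h₁⟩ := polyTime_iff.1 hbody
  -- Time of one iteration: `q₀ n` bounds the remaining list, `n` the argument, `q n` the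
  -- accumulator, and `2` counts the nodes that join them.
  let Z : ℕ → ℕ := fun n => q₁ (q₀ n + n + q n + 2)
  have hZ : PolyBdd Z := hq₁.comp (((hq₀.add PolyBdd.id).add hq).add (PolyBdd.const 2))
  refine ⟨p₀.seq ((Prog.whileLeft p₁).seq (Prog.right.seq Prog.right)),
    fun n => q₀ n + (q₀ n * (Z n + 5) + 5) + (11 * n + 23) + q n,
    ((hq₀.add ((hq₀.mul (hZ.add (PolyBdd.const 5))).add (PolyBdd.const 5))).add
      (((PolyBdd.const 11).mul PolyBdd.id).add (PolyBdd.const 23))).add hq, fun x => ?_⟩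
  have hsize := (h₀ x).1
  have hmap := (h₀ x).2
  have hbx := hb x
  have hxn : esize x ≤ esize x + μ x := Nat.le_add_right _ _
  generalize esize x + μ x = n at hsize hmap hbx hxn
  rw [esize_prod, esize_prod] at hsize
  dsimp only at hsize
  refine ⟨(hbx _ List.prefix_rfl).trans (Nat.le_add_left _ _), ?_⟩
  have hwhile : ∀ l₂ l₁, f x = l₁ ++ l₂ →
      Prog.Maps (Prog.whileLeft p₁) (Enc.enc (l₂, (x, l₁.foldl (h x) (g x))))
        (Enc.enc (([] : List A), (x, (f x).foldl (h x) (g x)))) (l₂.length * (Z n + 5) + 5) := by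
    intro l₂
    induction l₂ with
    | nil =>
      intro l₁ hl
      rw [List.append_nil] at hl
      rw [hl]
      exact (Prog.Maps.whileLeft_leaf p₁ _).mono (by omega)
    | cons a l₂ ih =>
      intro l₁ hl
      have hm := (h₁ ((a, l₂), (x, l₁.foldl (h x) (g x)))).2
      have hw := ih (l₁ ++ [a]) (by simp [hl])
      rw [List.foldl_append] at hw
      refine (Prog.Maps.whileLeft_node hm hw).mono ?_
      have e1 := hbx l₁ ⟨a :: l₂, hl.symm⟩
      have e2 : esize (a :: l₂) ≤ esize (f x) :=
        esize_le_of_sublist (hl ▸ List.sublist_append_right l₁ (a :: l₂))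
      rw [esize_cons] at e2
      have e3 : q₁ (esize ((a, l₂), (x, l₁.foldl (h x) (g x)))) ≤ Z n := by
        refine hq₁.mono ?_
        simp only [esize_prod]
        omega
      rw [List.length_cons, Nat.add_mul]
      omega
  have hlen : (f x).length ≤ q₀ n := by
    have := length_lt_esize (f x)
    omega
  have hlen' : (f x).length * (Z n + 5) ≤ q₀ n * (Z n + 5) := Nat.mul_le_mul_right _ hlen
  refine (hmap.comp ((hwhile (f x) [] rfl).comp ((Prog.maps_right _ _).comp
    (Prog.maps_right _ _)))).mono ?_
  change _ + (_ + (11 * 1 + 6 + (11 * esize x + 6))) ≤ _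
  dsimp only
  omega

theorem PolyTime.foldl_of_bound {f : X → List A} {g : X → B} {h : X → B → A → B}
    (hf : PolyTime f) (hg : PolyTime g) (hh : PolyTime fun p : X × B × A => h p.1 p.2.1 p.2.2)
    {q : ℕ → ℕ} (hq : PolyBdd q)
    (hb : ∀ x l, l <+: f x → esize (l.foldl (h x) (g x)) ≤ q (esize x)) :
    PolyTime fun x => (f x).foldl (h x) (g x) :=
  PolyTimeIn.foldl_of_bound hf hg hh hq hb

/-- A fold is computable in polynomial time if every step adds at most a polynomially bounded
amount to the size of the state. -/
theorem PolyTime.foldl {f : X → List A} {g : X → B} {h : X → B → A → B}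
    (hf : PolyTime f) (hg : PolyTime g) (hh : PolyTime fun p : X × B × A => h p.1 p.2.1 p.2.2)
    {q : ℕ → ℕ} (hq : PolyBdd q)
    (hb : ∀ x b, ∀ a ∈ f x, esize (h x b a) ≤ esize b + q (esize x)) :
    PolyTime fun x => (f x).foldl (h x) (g x) := by
  obtain ⟨q₁, hq₁, h₁⟩ := hf.size_bound
  obtain ⟨q₂, hq₂, h₂⟩ := hg.size_bound
  refine PolyTime.foldl_of_bound hf hg hh (q := fun n => q₁ n * q n + q₂ n)
    ((hq₁.mul hq).add hq₂) fun x l hl => ?_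
  have key : ∀ (l : List A) b, (∀ a ∈ l, a ∈ f x) →
      esize (l.foldl (h x) b) ≤ l.length * q (esize x) + esize b := by
    intro l
    induction l with
    | nil => simp
    | cons a l ih =>
      intro b hm
      have e1 := ih (h x b a) fun c hc => hm c (by simp [hc])
      have e2 := hb x b a (hm a (by simp))
      rw [List.foldl_cons, List.length_cons, Nat.add_mul]
      omega
  refine (key l (g x) fun a ha => hl.subset ha).trans (add_le_add (Nat.mul_le_mul_right _ ?_) (h₂ x))
  exact hl.length_le.trans ((length_lt_esize _).le.trans (h₁ x))

@[fun_prop]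
theorem PolyTime.ite {c : X → Bool} {f g : X → A} (hc : PolyTime c) (hf : PolyTime f)
    (hg : PolyTime g) : PolyTime fun x => if c x = true then f x else g x := by
  have : PolyTime fun p : Bool × X => if p.1 = true then f p.2 else g p.2 := by
    refine PolyTime.iteLeft hf hg ?_ ?_
    · intro a b h
      cases a with
      | true => exact absurd h (by simp [Enc.enc, BinTree.ofBool])
      | false => rfl
    · intro a b h
      cases a with
      | true => rfl
      | false => exact absurd rfl h
  exact this.comp (f := fun x => (c x, x)) (by fun_prop)

@[fun_prop]
theorem PolyTime.not {c : X → Bool} (hc : PolyTime c) : PolyTime fun x => !c x := by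
  have : (fun x => !c x) = fun x => if c x = true then false else true := by
    funext x; cases c x <;> rfl
  rw [this]; fun_prop

@[fun_prop]
theorem PolyTime.and {c d : X → Bool} (hc : PolyTime c) (hd : PolyTime d) :
    PolyTime fun x => c x && d x := by
  have : (fun x => c x && d x) = fun x => if c x = true then d x else false := by
    funext x; cases c x <;> rfl
  rw [this]; fun_prop

@[fun_prop]
theorem PolyTime.or {c d : X → Bool} (hc : PolyTime c) (hd : PolyTime d) :
    PolyTime fun x => c x || d x := by
  have : (fun x => c x || d x) = fun x => if c x = true then true else d x := by
    funext x; cases c x <;> rfl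
  rw [this]; fun_prop

/-! ### Lists -/

@[fun_prop]
theorem PolyTime.isEmpty {l : X → List A} (hl : PolyTime l) : PolyTime fun x => (l x).isEmpty := by
  have : PolyTime fun p : List A × Unit => p.1.isEmpty := by
    refine PolyTime.iteLeft (PolyTime.const false) (PolyTime.const true) ?_ ?_
    · intro a b h
      cases a with
      | nil => rfl
      | cons a l => exact absurd h (by simp [Enc.enc, BinTree.ofList])
    · intro a b h
      cases a with
      | nil => exact absurd rfl h
      | cons a l => rfl
  exact this.comp (f := fun x => (l x, ())) (by fun_prop)

@[fun_prop]
theorem PolyTime.cons {f : X → A} {l : X → List A} (hf : PolyTime f) (hl : PolyTime l) :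
    PolyTime fun x => f x :: l x := by
  have : PolyTime fun p : A × List A => p.1 :: p.2 := PolyTime.of_enc_eq fun _ => rfl
  exact this.comp (f := fun x => (f x, l x)) (by fun_prop)

/-- A case distinction on a list. -/
theorem PolyTime.listCases {F : List A → B → C} (h0 : PolyTime fun b => F [] b)
    (h1 : PolyTime fun p : (A × List A) × B => F (p.1.1 :: p.1.2) p.2) :
    PolyTime fun p : List A × B => F p.1 p.2 := by
  obtain ⟨p₁, q₁, hq₁, h₁⟩ := polyTime_iff.1 h1
  obtain ⟨p₂, q₂, hq₂, h₂⟩ := polyTime_iff.1 ((h0.comp PolyTime.snd' : PolyTime fun p : List A × B => F [] p.2))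
  -- `iteLeft` discards the tree that it tests, so the list is copied first; both branches then
  -- still see the whole pair.
  obtain ⟨p₀, q₀, hq₀, h₀⟩ := polyTime_iff.1
    (by fun_prop : PolyTime fun p : List A × B => (p.1, p))
  refine polyTime_iff.2 ⟨p₀.seq (p₁.iteLeft p₂), fun n => q₀ n + (q₁ n + q₂ n + 11 * n + 22),
    hq₀.add (((hq₁.add hq₂).add ((PolyBdd.const 11).mul PolyBdd.id)).add (PolyBdd.const 22)), ?_⟩
  rintro ⟨l, b⟩
  dsimp only
  cases l with
  | nil =>
    exact ⟨(h₂ ([], b)).1.trans (by omega), ((h₀ ([], b)).2.comp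
      (Prog.Maps.iteLeft_leaf (h₂ ([], b)).2)).mono (by omega)⟩
  | cons a l =>
    have e : esize ((a, l), b) = esize (a :: l, b) := rfl
    have h := h₁ ((a, l), b)
    rw [e] at h
    refine ⟨h.1.trans (by omega), ((h₀ (a :: l, b)).2.comp
      (Prog.Maps.iteLeft_node h.2)).mono ?_⟩
    change _ + (_ + 11 * esize (a :: l) + 11) ≤ _
    have : esize (a :: l) ≤ esize (a :: l, b) := by rw [esize_prod]; dsimp only; omega
    omega

@[fun_prop]
theorem PolyTime.tail {l : X → List A} (hl : PolyTime l) : PolyTime fun x => (l x).tail :=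
  (PolyTime.listCases (F := fun (l : List A) (_ : Unit) => l.tail)
    (by dsimp only [List.tail]; fun_prop) (by dsimp only [List.tail]; fun_prop)).comp
    (f := fun x => (l x, ())) (by fun_prop)

@[fun_prop]
theorem PolyTime.headD {l : X → List A} {d : X → A} (hl : PolyTime l) (hd : PolyTime d) :
    PolyTime fun x => (l x).headD (d x) :=
  (PolyTime.listCases (F := fun (l : List A) (d : A) => l.headD d)
    (by dsimp only [List.headD]; fun_prop) (by dsimp only [List.headD]; fun_prop)).comp
    (f := fun x => (l x, d x)) (by fun_prop)

@[fun_prop]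
theorem PolyTime.reverse {l : X → List A} (hl : PolyTime l) : PolyTime fun x => (l x).reverse := by
  have h := PolyTime.foldl (f := l) (g := fun _ => ([] : List A)) (h := fun _ b a => a :: b) hl
    (by fun_prop) (by fun_prop) (q := fun n => hl.size_bound.choose n + 1)
    (hl.size_bound.choose_spec.1.add (PolyBdd.const 1)) (fun x b a ha => by
      have := (esize_le_of_mem ha).trans (hl.size_bound.choose_spec.2 x)
      rw [esize_cons]
      omega)
  have e : ∀ (l b : List A), l.foldl (fun b a => a :: b) b = l.reverse ++ b := by
    intro l
    induction l with
    | nil => simp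
    | cons a l ih => intro b; simp [ih]
  simpa [e] using h

@[fun_prop]
theorem PolyTime.append {l l' : X → List A} (hl : PolyTime l) (hl' : PolyTime l') :
    PolyTime fun x => l x ++ l' x := by
  have h := PolyTime.foldl (f := fun x => (l x).reverse) (g := l') (h := fun _ b a => a :: b)
    (by fun_prop) hl' (by fun_prop) (q := fun n => hl.size_bound.choose n + 1)
    (hl.size_bound.choose_spec.1.add (PolyBdd.const 1)) (fun x b a ha => by
      have := (esize_le_of_mem (List.mem_reverse.1 ha)).trans (hl.size_bound.choose_spec.2 x)
      rw [esize_cons]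
      omega)
  have e : ∀ (l b : List A), l.foldl (fun b a => a :: b) b = l.reverse ++ b := by
    intro l
    induction l with
    | nil => simp
    | cons a l ih => intro b; simp [ih]
  simpa [e] using h

@[fun_prop]
theorem PolyTime.flatMap {l : X → List A} {f : X → A → List B} (hl : PolyTime l)
    (hf : PolyTime fun p : X × A => f p.1 p.2) : PolyTime fun x => (l x).flatMap (f x) := by
  obtain ⟨q, hq, hb⟩ := PolyTime.size_bound_mem hl hf
  have hf' : PolyTime fun p : X × List B × A => f p.1 p.2.2 :=
    hf.comp (f := fun p : X × List B × A => (p.1, p.2.2)) (by fun_prop)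
  have h := PolyTime.foldl (f := l) (g := fun _ => ([] : List B)) (h := fun x b a => b ++ f x a) hl
    (by fun_prop) (by fun_prop) hq (fun x b a ha => by
      have := esize_append b (f x a)
      have := hb x a ha
      omega)
  have e : ∀ (g : A → List B) (l : List A) b, l.foldl (fun b a => b ++ g a) b = b ++ l.flatMap g := by
    intro g l
    induction l with
    | nil => simp
    | cons a l ih => intro b; simp [ih]
  simpa [e] using h

@[fun_prop]
theorem PolyTime.map {l : X → List A} {f : X → A → B} (hl : PolyTime l)
    (hf : PolyTime fun p : X × A => f p.1 p.2) : PolyTime fun x => (l x).map (f x) := by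
  simp only [List.map_eq_flatMap]
  exact PolyTime.flatMap hl (hf.cons (PolyTime.const []))

@[fun_prop]
theorem PolyTime.filter {l : X → List A} {f : X → A → Bool} (hl : PolyTime l)
    (hf : PolyTime fun p : X × A => f p.1 p.2) : PolyTime fun x => (l x).filter (f x) := by
  have e : ∀ (g : A → Bool) (l : List A),
      l.filter g = l.flatMap fun a => if g a = true then [a] else [] := by
    intro g l
    induction l with
    | nil => rfl
    | cons a l ih => cases h : g a <;> simp [h, ih]
  simp only [e]
  exact PolyTime.flatMap hl (by fun_prop)

@[fun_prop]
theorem PolyTime.any {l : X → List A} {f : X → A → Bool} (hl : PolyTime l)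
    (hf : PolyTime fun p : X × A => f p.1 p.2) : PolyTime fun x => (l x).any (f x) := by
  have e : ∀ (g : A → Bool) (l : List A), l.any g = !(l.filter g).isEmpty := by
    intro g l
    induction l with
    | nil => rfl
    | cons a l ih => cases h : g a <;> simp [h, ih]
  simp only [e]
  fun_prop

@[fun_prop]
theorem PolyTime.all {l : X → List A} {f : X → A → Bool} (hl : PolyTime l)
    (hf : PolyTime fun p : X × A => f p.1 p.2) : PolyTime fun x => (l x).all (f x) := by
  simp only [List.all_eq_not_any_not]
  fun_prop

/-! ### Natural numbers -/

/-- Reduces unary arithmetic to lists: addition is concatenation, truncated subtraction is `drop`,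
comparison is a test for emptiness. -/
theorem enc_nat (n : ℕ) : Enc.enc n = Enc.enc (List.replicate n ()) := by
  induction n with
  | zero => rfl
  | succ n ih => exact congrArg (BinTree.node .leaf) ih

@[fun_prop]
theorem PolyTime.replicate_unit {f : X → ℕ} (hf : PolyTime f) :
    PolyTime fun x => List.replicate (f x) () :=
  (PolyTime.of_enc_eq fun n : ℕ => (enc_nat n).symm).comp hf

@[fun_prop]
theorem PolyTime.length {l : X → List A} (hl : PolyTime l) : PolyTime fun x => (l x).length := by
  have h : PolyTime fun x => ((l x).map fun _ => ()).length := by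
    refine PolyTime.comp (g := fun l : List Unit => l.length) (PolyTime.of_enc_eq fun l => ?_)
      (by fun_prop)
    rw [enc_nat]
    congr 1
    exact (List.eq_replicate_length.2 fun _ _ => rfl).symm
  simpa using h

@[fun_prop]
theorem PolyTime.natAdd {f g : X → ℕ} (hf : PolyTime f) (hg : PolyTime g) :
    PolyTime fun x => f x + g x := by
  have h : PolyTime fun x => (List.replicate (f x) () ++ List.replicate (g x) ()).length := by
    fun_prop
  simpa using h

@[fun_prop]
theorem PolyTime.natMul {f g : X → ℕ} (hf : PolyTime f) (hg : PolyTime g) :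
    PolyTime fun x => f x * g x := by
  have h : PolyTime fun x =>
      ((List.replicate (f x) ()).flatMap fun _ => List.replicate (g x) ()).length := by
    fun_prop
  simpa using h

@[fun_prop]
theorem PolyTime.drop {f : X → ℕ} {l : X → List A} (hf : PolyTime f) (hl : PolyTime l) :
    PolyTime fun x => (l x).drop (f x) := by
  have h := PolyTime.foldl (f := fun x => List.replicate (f x) ()) (g := l)
    (h := fun _ b _ => b.tail) (by fun_prop) hl (by fun_prop) (PolyBdd.const 0)
    (fun x b a ha => esize_le_of_sublist (List.tail_sublist b))
  have e : ∀ n (l : List A), (List.replicate n ()).foldl (fun b _ => b.tail) l = l.drop n := by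
    intro n
    induction n with
    | zero => simp
    | succ n ih => intro l; simp [List.replicate_succ, ih]
  simpa only [e] using h

@[fun_prop]
theorem PolyTime.getD {l : X → List A} {f : X → ℕ} {d : X → A} (hl : PolyTime l) (hf : PolyTime f)
    (hd : PolyTime d) : PolyTime fun x => (l x).getD (f x) (d x) := by
  have h : PolyTime fun x => ((l x).drop (f x)).headD (d x) := by fun_prop
  have e : ∀ n (l : List A) d, (l.drop n).headD d = l.getD n d := by
    intro n l d
    simp [List.headD_eq_head?_getD, List.head?_drop]
  simpa only [e] using h

@[fun_prop]
theorem PolyTime.natSub {f g : X → ℕ} (hf : PolyTime f) (hg : PolyTime g) :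
    PolyTime fun x => f x - g x := by
  have h : PolyTime fun x => ((List.replicate (f x) ()).drop (g x)).length := by fun_prop
  simpa using h

@[fun_prop]
theorem PolyTime.decide_le {f g : X → ℕ} (hf : PolyTime f) (hg : PolyTime g) :
    PolyTime fun x => decide (f x ≤ g x) := by
  have h : PolyTime fun x => (List.replicate (f x - g x) ()).isEmpty := by fun_prop
  have e : ∀ a b : ℕ, (List.replicate (a - b) ()).isEmpty = decide (a ≤ b) := by
    intro a b
    rw [Bool.eq_iff_iff]
    simp [Nat.sub_eq_zero_iff_le]
  simpa only [e] using h

@[fun_prop]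
theorem PolyTime.decide_lt {f g : X → ℕ} (hf : PolyTime f) (hg : PolyTime g) :
    PolyTime fun x => decide (f x < g x) := by
  have h : PolyTime fun x => decide (f x + 1 ≤ g x) := by fun_prop
  exact h

@[fun_prop]
theorem PolyTime.decide_eq {f g : X → ℕ} (hf : PolyTime f) (hg : PolyTime g) :
    PolyTime fun x => decide (f x = g x) := by
  have h : PolyTime fun x => decide (f x ≤ g x) && decide (g x ≤ f x) := by fun_prop
  simpa only [← Bool.decide_and, ← le_antisymm_iff] using h

@[fun_prop]
theorem PolyTime.range {f : X → ℕ} (hf : PolyTime f) : PolyTime fun x => List.range (f x) := by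
  obtain ⟨q, hq, hb⟩ := hf.size_bound
  have e : ∀ l : List Unit, l.foldl (fun (b : List ℕ) _ => b ++ [b.length]) [] =
      List.range l.length := by
    intro l
    induction l using List.reverseRecOn with
    | nil => rfl
    | append_singleton l a ih => simp [ih, List.range_succ]
  have h := PolyTime.foldl_of_bound (f := fun x => List.replicate (f x) ())
    (g := fun _ => ([] : List ℕ)) (h := fun _ b _ => b ++ [b.length])
    (by fun_prop) (by fun_prop) (by fun_prop) (q := fun n => q n * (q n + 1) + 1)
    ((hq.mul (hq.add (PolyBdd.const 1))).add (PolyBdd.const 1)) (fun x l hl => by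
      rw [e]
      have hn := hb x
      have hl' := hl.length_le
      rw [List.length_replicate] at hl'
      rw [esize_nat] at hn
      refine (esize_le_mul (n := q (esize x)) fun a ha => ?_).trans ?_
      · rw [List.mem_range] at ha
        rw [esize_nat]
        omega
      · rw [List.length_range]
        have : l.length ≤ q (esize x) := by omega
        gcongr)
  simpa [e] using h

end closure

/-! ### Token sliding and assignments of targets -/

section assignment

variable {V : Type} [DecidableEq V]

/-- The graph on the edges of `G` in which edges that share a vertex are adjacent. -/
def edgeGraph (G : SimpleGraph V) : SimpleGraph (Sym2 V) where
  Adj e f := e ∈ G.edgeSet ∧ f ∈ G.edgeSet ∧ e ≠ f ∧ ∃ v, v ∈ e ∧ v ∈ f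
  symm := ⟨fun _ _ ⟨he, hf, hne, v, h, h'⟩ => ⟨hf, he, hne.symm, v, h', h⟩⟩
  loopless := ⟨fun _ h => h.2.2.1 rfl⟩

/-- The tokens on `S` can be assigned bijectively to targets in `T`, at a total distance of at most
`c`. -/
def Assignable (G : SimpleGraph V) (S T : Finset (Sym2 V)) (c : ℕ) : Prop :=
  ∃ t : Sym2 V → Sym2 V, Set.BijOn t S T ∧ ∑ e ∈ S, (edgeGraph G).edist e (t e) ≤ c

/-- `T` is reached from `S` by exactly `l` token slides. -/
inductive SlidesTo (G : SimpleGraph V) : Finset (Sym2 V) → Finset (Sym2 V) → ℕ → Prop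
  | refl (S) : SlidesTo G S S 0
  | head {S S' T l} : TokenSlide G S S' → SlidesTo G S' T l → SlidesTo G S T (l + 1)

theorem slidesTo_of_forall_lt (G : SimpleGraph V) (l : ℕ) (C : ℕ → Finset (Sym2 V))
    (h : ∀ i < l, TokenSlide G (C i) (C (i + 1))) : SlidesTo G (C 0) (C l) l := by
  induction l generalizing C with
  | zero => exact .refl _
  | succ l ih => exact .head (h 0 (by omega)) (ih (fun i => C (i + 1)) fun i hi => h (i + 1) (by omega))

theorem SlidesTo.exists_seq {G : SimpleGraph V} {S T : Finset (Sym2 V)} {l : ℕ}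
    (h : SlidesTo G S T l) : ∃ C : ℕ → Finset (Sym2 V), C 0 = S ∧
      (∀ i < l, TokenSlide G (C i) (C (i + 1))) ∧ C l = T := by
  induction h with
  | refl S => exact ⟨fun _ => S, rfl, by simp, rfl⟩
  | @head S S' T l hs _ ih =>
    obtain ⟨C, h0, hC, hl⟩ := ih
    refine ⟨fun i => if i = 0 then S else C (i - 1), rfl, fun i hi => ?_, by simpa using hl⟩
    cases i with
    | zero => simpa [h0] using hs
    | succ i => simpa using hC i (by omega)

variable {G : SimpleGraph V} {S S' T : Finset (Sym2 V)}

/-- The token on `y` inherits the target of `x`. As `x` and `y` are adjacent in the line graph, the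
triangle inequality bounds the extra cost by one. -/
theorem Assignable.of_slide {c : ℕ} (hS : ∀ e ∈ S, e ∈ G.edgeSet) (hs : TokenSlide G S S')
    (h : Assignable G S' T c) : Assignable G S T (c + 1) := by
  obtain ⟨y, hy, x, hxG, hx, hv, rfl⟩ := hs
  obtain ⟨t, ht, hc⟩ := h
  have hxy : x ≠ y := fun h => hx (h ▸ hy)
  have hxe : x ∉ S.erase y := fun h => hx (Finset.mem_of_mem_erase h)
  refine ⟨fun e => if e = y then t x else t e, ?_, ?_⟩
  · rw [Finset.coe_insert] at ht
    have hSy : (S : Set (Sym2 V)) = (insert y ↑(S.erase y) : Set (Sym2 V)) := by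
      rw [← Finset.coe_insert, Finset.insert_erase hy]
    rw [hSy]
    have heq : ∀ e ∈ S.erase y, (if e = y then t x else t e) = t e := fun e he =>
      if_neg (Finset.ne_of_mem_erase he)
    refine ⟨?_, ?_, ?_⟩
    · rintro e (rfl | he)
      · simpa using ht.mapsTo (Set.mem_insert x _)
      · simpa only [heq e he] using ht.mapsTo (Set.mem_insert_of_mem x he)
    · have key : ∀ e ∈ S.erase y, t e ≠ t x := fun e he h =>
        hxe (ht.injOn (Set.mem_insert_of_mem x he) (Set.mem_insert x _) h ▸ he)
      rintro e (rfl | he) f (rfl | hf) hef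
      · rfl
      · simp only [if_true, heq f hf] at hef
        exact absurd hef.symm (key f hf)
      · simp only [if_true, heq e he] at hef
        exact absurd hef (key e he)
      · simp only [heq e he, heq f hf] at hef
        exact ht.injOn (Set.mem_insert_of_mem x he) (Set.mem_insert_of_mem x hf) hef
    · intro a ha
      obtain ⟨e, rfl | he, rfl⟩ := ht.surjOn ha
      · exact ⟨y, Set.mem_insert _ _, if_pos rfl⟩
      · exact ⟨e, Set.mem_insert_of_mem _ he, heq e he⟩
  · rw [Finset.sum_insert hxe] at hc
    rw [← Finset.add_sum_erase S _ hy]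
    have h1 : ∑ e ∈ S.erase y, (edgeGraph G).edist e (if e = y then t x else t e) =
        ∑ e ∈ S.erase y, (edgeGraph G).edist e (t e) :=
      Finset.sum_congr rfl fun e he => by rw [if_neg (Finset.ne_of_mem_erase he)]
    have hadj : (edgeGraph G).Adj y x :=
      ⟨hS y hy, hxG, hxy.symm, hv.choose, hv.choose_spec.2, hv.choose_spec.1⟩
    have h2 := (edgeGraph G).edist_triangle (u := y) (v := x) (w := t x)
    rw [SimpleGraph.edist_eq_one_iff_adj.2 hadj] at h2
    simp only [h1, if_pos]
    calc _ ≤ 1 + (edgeGraph G).edist x (t x) + _ := by gcongr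
      _ = ((edgeGraph G).edist x (t x) + ∑ e ∈ S.erase y, (edgeGraph G).edist e (t e)) + 1 := by ring
      _ ≤ c + 1 := by gcongr
      _ = _ := by push_cast; rfl

theorem TokenSlide.subset_edgeSet (hS : ∀ e ∈ S, e ∈ G.edgeSet) (hs : TokenSlide G S S') :
    ∀ e ∈ S', e ∈ G.edgeSet := by
  obtain ⟨y, hy, x, hxG, hx, hv, rfl⟩ := hs
  intro e he
  rcases Finset.mem_insert.1 he with rfl | he
  · exact hxG
  · exact hS e (Finset.mem_of_mem_erase he)

theorem TokenSlide.card_eq (hs : TokenSlide G S S') : S'.card = S.card := by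
  obtain ⟨y, hy, x, hxG, hx, hv, rfl⟩ := hs
  rw [Finset.card_insert_of_notMem fun h => hx (Finset.mem_of_mem_erase h),
    Finset.card_erase_add_one hy]

theorem SlidesTo.assignable {l : ℕ} (h : SlidesTo G S T l) (hS : ∀ e ∈ S, e ∈ G.edgeSet) :
    Assignable G S T l := by
  induction h with
  | refl S => exact ⟨id, Set.bijOn_id _, by simp⟩
  | head hs _ ih => exact (ih (hs.subset_edgeSet hS)).of_slide hS hs

theorem exists_adj_of_edist_eq_succ {W : Type} {L : SimpleGraph W} {u v : W} {n : ℕ}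
    (h : L.edist u v = (n + 1 : ℕ)) : ∃ f, L.Adj u f ∧ L.edist f v ≤ n := by
  obtain ⟨w, hw⟩ := SimpleGraph.exists_walk_of_edist_eq_coe h
  cases w with
  | nil => simp at hw
  | @cons _ f _ hadj w =>
    simp only [SimpleGraph.Walk.length_cons, add_left_inj] at hw
    exact ⟨f, hadj, hw ▸ SimpleGraph.edist_le w⟩

/-- If a target is free, then some token slide decreases the cost of an assignment. -/
theorem exists_slide_of_free {c : ℕ} (n : ℕ) (t : Sym2 V → Sym2 V) (ht : Set.BijOn t S T)
    (hc : ∑ e ∈ S, (edgeGraph G).edist e (t e) ≤ (c + 1 : ℕ)) (e : Sym2 V) (he : e ∈ S)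
    (hte : t e ∉ S) (hn : (edgeGraph G).edist e (t e) = n) :
    ∃ S', TokenSlide G S S' ∧ Assignable G S' T c := by
  -- Induction on the distance from `e` to its free target. Let `f` be the next edge on a shortest
  -- route. If `f` is free, the token slides there. If `f` carries a token, the two tokens exchange
  -- targets, which does not raise the cost, and the free target now belongs to `f`, at distance
  -- `n`.
  induction n generalizing t e with
  | zero =>
    rw [Nat.cast_zero, SimpleGraph.edist_eq_zero_iff] at hn
    exact absurd (hn ▸ he) hte
  | succ n ih =>
    obtain ⟨f, hadj, hf⟩ := exists_adj_of_edist_eq_succ hn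
    · have hne : f ≠ e := hadj.ne'
      by_cases hfS : f ∈ S
      · -- exchange the targets of `e` and `f`
        let t' : Sym2 V → Sym2 V := fun g => t (Equiv.swap e f g)
        have hswap : Set.BijOn (Equiv.swap e f) S S := by
          refine ⟨fun g hg => ?_, (Equiv.injective _).injOn, fun g hg => ⟨Equiv.swap e f g, ?_, by simp⟩⟩
          all_goals
            rw [Equiv.swap_apply_def]
            split_ifs <;> assumption
        have ht' : Set.BijOn t' S T := ht.comp hswap
        have hfn : t' f = t e := by simp [t']
        have hen : t' e = t f := by simp [t']
        have hfe : f ∈ S.erase e := Finset.mem_erase.2 ⟨hne, hfS⟩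
        have hle : ∑ e ∈ S, (edgeGraph G).edist e (t' e) ≤ ∑ e ∈ S, (edgeGraph G).edist e (t e) := by
          rw [← Finset.add_sum_erase S _ he, ← Finset.add_sum_erase _ _ hfe,
            ← Finset.add_sum_erase S (fun e => (edgeGraph G).edist e (t e)) he,
            ← Finset.add_sum_erase _ (fun e => (edgeGraph G).edist e (t e)) hfe, hfn, hen, hn]
          have h1 : ∑ g ∈ (S.erase e).erase f, (edgeGraph G).edist g (t' g) =
              ∑ g ∈ (S.erase e).erase f, (edgeGraph G).edist g (t g) := by
            refine Finset.sum_congr rfl fun g hg => ?_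
            rw [Finset.mem_erase, Finset.mem_erase] at hg
            simp only [t', Equiv.swap_apply_of_ne_of_ne hg.2.1 hg.1]
          have h2 := (edgeGraph G).edist_triangle (u := e) (v := f) (w := t f)
          rw [SimpleGraph.edist_eq_one_iff_adj.2 hadj] at h2
          rw [h1]
          calc _ ≤ (1 + (edgeGraph G).edist f (t f)) + (n + ∑ g ∈ (S.erase e).erase f,
                (edgeGraph G).edist g (t g)) := by gcongr
            _ = _ := by push_cast; ring
        have hn' : (edgeGraph G).edist f (t e) = n := by
          refine le_antisymm hf ?_
          have h2 := (edgeGraph G).edist_triangle (u := e) (v := f) (w := t e)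
          rw [SimpleGraph.edist_eq_one_iff_adj.2 hadj, hn] at h2
          push_cast at h2
          rw [add_comm (1 : ℕ∞)] at h2
          exact (ENat.add_le_add_iff_right (by simp)).1 h2
        exact ih t' ht' (hle.trans hc) f hfS (hfn ▸ hte) (hfn ▸ hn')
      · have hfe : f ∉ S.erase e := fun h => hfS (Finset.mem_of_mem_erase h)
        obtain ⟨_, hfG, _, v, hv, hv'⟩ := hadj
        refine ⟨insert f (S.erase e), ⟨e, he, f, hfG, hfS, ⟨v, hv', hv⟩, rfl⟩,
          fun g => if g = f then t e else t g, ?_, ?_⟩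
        · have heq : ∀ g ∈ S.erase e, (if g = f then t e else t g) = t g := fun g hg =>
            if_neg fun h : g = f => hfe (h ▸ hg)
          rw [Finset.coe_insert]
          refine ⟨?_, ?_, ?_⟩
          · rintro g (rfl | hg)
            · simpa using ht.mapsTo he
            · simpa only [heq g hg] using ht.mapsTo (Finset.mem_of_mem_erase hg)
          · have key : ∀ g ∈ S.erase e, t g ≠ t e := fun g hg h =>
              Finset.ne_of_mem_erase hg (ht.injOn (Finset.mem_of_mem_erase hg) he h)
            rintro g (rfl | hg) g' (rfl | hg') hgg
            · rfl
            · simp only [if_true, heq g' hg'] at hgg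
              exact absurd hgg.symm (key g' hg')
            · simp only [if_true, heq g hg] at hgg
              exact absurd hgg (key g hg)
            · simp only [heq g hg, heq g' hg'] at hgg
              exact ht.injOn (Finset.mem_of_mem_erase hg) (Finset.mem_of_mem_erase hg') hgg
          · intro a ha
            obtain ⟨g, hg, rfl⟩ := ht.surjOn ha
            by_cases hge : g = e
            · exact ⟨f, Set.mem_insert _ _, by simp [hge]⟩
            · have : g ∈ S.erase e := Finset.mem_erase.2 ⟨hge, hg⟩
              exact ⟨g, Set.mem_insert_of_mem _ this, heq g this⟩
        · rw [Finset.sum_insert hfe]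
          rw [← Finset.add_sum_erase S _ he, hn] at hc
          have h1 : ∑ g ∈ S.erase e, (edgeGraph G).edist g (if g = f then t e else t g) =
              ∑ g ∈ S.erase e, (edgeGraph G).edist g (t g) :=
            Finset.sum_congr rfl fun g hg => by rw [if_neg fun h : g = f => hfe (h ▸ hg)]
          simp only [h1, if_pos]
          refine (add_le_add_left hf _).trans ?_
          refine (ENat.add_le_add_iff_right (ENat.natCast_ne_top 1)).1 ?_
          push_cast at hc ⊢
          rwa [add_right_comm]

/-- Induction on the cost. If all targets are occupied, then `S = T` by cardinality and no slide is
needed; otherwise `exists_slide_of_free` lowers the cost by one. -/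
theorem Assignable.slidesTo {c : ℕ} (h : Assignable G S T c) : ∃ l ≤ c, SlidesTo G S T l := by
  induction c generalizing S with
  | zero =>
    obtain ⟨t, ht, hc⟩ := h
    refine ⟨0, le_rfl, ?_⟩
    have h0 : ∀ e ∈ S, t e = e := fun e he => by
      have := Finset.sum_eq_zero_iff.1 (le_antisymm hc zero_le) e he
      exact (SimpleGraph.edist_eq_zero_iff.1 this).symm
    have : S = T := by
      rw [← Finset.coe_inj, ← ht.image_eq]
      exact (Set.image_congr h0).trans (Set.image_id _) |>.symm
    exact this ▸ .refl S
  | succ c ih =>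
    by_cases hTS : T ⊆ S
    · obtain ⟨t, ht, _⟩ := h
      have hcard : S.card ≤ T.card := by
        have := ht.injOn.ncard_image
        rw [ht.image_eq, Set.ncard_coe_finset, Set.ncard_coe_finset] at this
        exact this.ge
      exact ⟨0, by omega, Finset.eq_of_subset_of_card_le hTS hcard ▸ .refl T⟩
    · obtain ⟨a, haT, haS⟩ := Finset.not_subset.1 hTS
      obtain ⟨t, ht, hc⟩ := h
      obtain ⟨e, he, rfl⟩ := ht.surjOn haT
      have hlt : (edgeGraph G).edist e (t e) ≠ ⊤ := fun h => by
        have := (Finset.single_le_sum (f := fun e => (edgeGraph G).edist e (t e))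
          (fun _ _ => zero_le) he).trans hc
        rw [h, top_le_iff] at this
        exact ENat.natCast_ne_top _ this
      obtain ⟨n, hn⟩ := ENat.ne_top_iff_exists.1 hlt
      obtain ⟨S', hs, ha⟩ := exists_slide_of_free n t ht hc e he haS hn.symm
      obtain ⟨l, hl, h⟩ := ih ha
      exact ⟨l + 1, by omega, .head hs h⟩

theorem SlidesTo.card_eq {l : ℕ} (h : SlidesTo G S T l) : T.card = S.card := by
  induction h with
  | refl => rfl
  | head hs _ ih => rw [ih, hs.card_eq]

/-- The intermediate configurations disappear: only the final matching and the distances to it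
matter. -/
theorem matchingDiscoverable_iff (hS : ∀ e ∈ S, e ∈ G.edgeSet) (b : ℕ) :
    MatchingDiscoverable G S b ↔ ∃ T, IsEdgeMatching G T ∧ Assignable G S T b := by
  constructor
  · rintro ⟨l, hl, C, rfl, hC, hM, _⟩
    obtain ⟨t, ht, hc⟩ := (slidesTo_of_forall_lt G l C hC).assignable hS
    exact ⟨C l, hM, t, ht, hc.trans (by exact_mod_cast hl)⟩
  · rintro ⟨T, hT, ha⟩
    obtain ⟨l, hl, h⟩ := ha.slidesTo
    have hcard := h.card_eq
    obtain ⟨C, h0, hC, rfl⟩ := h.exists_seq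
    exact ⟨l, hl, C, h0, hC, hT, hcard⟩

end assignment

/-! ### Candidates for the targets of a token -/

/-- The edge `e`, given as a pair of vertices, contains the vertex `v`. -/
def touches (v : ℕ) (e : ℕ × ℕ) : Bool := decide (e.1 = v) || decide (e.2 = v)

/-- Two edges share a vertex. -/
def meets (e f : ℕ × ℕ) : Bool := touches f.1 e || touches f.2 e

/-- The edges in `E` that share a vertex with an edge in `R`. -/
def expand (E R : List (ℕ × ℕ)) : List (ℕ × ℕ) := E.filter fun e => R.any fun f => meets e f

/-- The number of candidates that contain the vertex `v`. -/
def degreeIn (K : List ((ℕ × ℕ) × ℕ)) (v : ℕ) : ℕ := (K.filter fun p => touches v p.1).length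

/-- Add the edge `e`, at distance `i`, to the candidates unless they represent it already. -/
def addCandidate (D i : ℕ) (K : List ((ℕ × ℕ) × ℕ)) (e : ℕ × ℕ) : List ((ℕ × ℕ) × ℕ) :=
  if decide (K.length ≤ D * D) && decide (degreeIn K e.1 < D) && decide (degreeIn K e.2 < D) &&
      !K.any (fun p => decide (p.1.1 = e.1) && decide (p.1.2 = e.2)) then (e, i) :: K else K

/-- One step of the search: `R` holds the edges at distance at most `i` from the token, and `K` the
candidates at distance less than `i`. -/
def searchStep (D : ℕ) (E : List (ℕ × ℕ)) (s : List (ℕ × ℕ) × List ((ℕ × ℕ) × ℕ)) (i : ℕ) :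
    List (ℕ × ℕ) × List ((ℕ × ℕ) × ℕ) :=
  (expand E s.1, s.1.foldl (addCandidate D i) s.2)

/-- The candidates for the target of a token on `e`, with their distances, which are less
than `m`. -/
def candidates (D : ℕ) (E : List (ℕ × ℕ)) (m : ℕ) (e : ℕ × ℕ) : List ((ℕ × ℕ) × ℕ) :=
  ((List.range m).foldl (searchStep D E) ([e], [])).2

/-! ### Correctness of the candidate search -/

@[simp] theorem touches_eq_true {v : ℕ} {e : ℕ × ℕ} : touches v e = true ↔ e.1 = v ∨ e.2 = v := by
  simp [touches]

theorem meets_eq_true {e f : ℕ × ℕ} :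
    meets e f = true ↔ ∃ v, touches v e = true ∧ touches v f = true := by
  simp only [meets, Bool.or_eq_true, touches_eq_true]
  constructor
  · rintro (h | h)
    · exact ⟨f.1, h, Or.inl rfl⟩
    · exact ⟨f.2, h, Or.inr rfl⟩
  · rintro ⟨v, h, rfl | rfl⟩
    · exact Or.inl h
    · exact Or.inr h

theorem meets_comm (e f : ℕ × ℕ) : meets e f = meets f e := by
  rw [Bool.eq_iff_iff, meets_eq_true, meets_eq_true]
  simp only [and_comm]

theorem meets_self (e : ℕ × ℕ) : meets e e = true := by simp [meets]

/-- The candidates `K` represent the edge `e` at distance `i`: whenever `e` avoids a set of less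
than `D` vertices, so does a candidate at distance at most `i`. -/
def Represents (D : ℕ) (K : List ((ℕ × ℕ) × ℕ)) (e : ℕ × ℕ) (i : ℕ) : Prop :=
  ∀ X : Finset ℕ, X.card < D → e.1 ∉ X → e.2 ∉ X → ∃ p ∈ K, p.2 ≤ i ∧ p.1.1 ∉ X ∧ p.1.2 ∉ X

/-- The invariant of the lists of candidates. -/
structure IsCandidateList (D i : ℕ) (K : List ((ℕ × ℕ) × ℕ)) : Prop where
  le : ∀ p ∈ K, p.2 ≤ i
  lt : ∀ p ∈ K, p.1.1 < p.1.2
  nodup : (K.map Prod.fst).Nodup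
  degree_le : ∀ v, degreeIn K v ≤ D
  length_le : K.length ≤ D * D + 1

theorem Represents.mono {D i : ℕ} {K K' : List ((ℕ × ℕ) × ℕ)} {e : ℕ × ℕ} (h : Represents D K e i)
    (hK : K ⊆ K') : Represents D K' e i := fun X hX h1 h2 =>
  let ⟨p, hp, h⟩ := h X hX h1 h2
  ⟨p, hK hp, h⟩

theorem subset_addCandidate (D i : ℕ) (K : List ((ℕ × ℕ) × ℕ)) (e : ℕ × ℕ) :
    K ⊆ addCandidate D i K e := by
  unfold addCandidate
  split_ifs
  · exact List.subset_cons_self _ _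
  · exact List.Subset.refl _

theorem eq_or_mem_of_mem_addCandidate {D i : ℕ} {K : List ((ℕ × ℕ) × ℕ)} {e : ℕ × ℕ}
    {p : (ℕ × ℕ) × ℕ} (h : p ∈ addCandidate D i K e) : p = (e, i) ∨ p ∈ K := by
  unfold addCandidate at h
  split_ifs at h
  · exact List.mem_cons.1 h
  · exact Or.inr h

theorem IsCandidateList.mono {D i j : ℕ} {K : List ((ℕ × ℕ) × ℕ)} (h : IsCandidateList D i K)
    (hij : i ≤ j) : IsCandidateList D j K :=
  ⟨fun p hp => (h.le p hp).trans hij, h.lt, h.nodup, h.degree_le, h.length_le⟩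

theorem IsCandidateList.addCandidate {D i : ℕ} {K : List ((ℕ × ℕ) × ℕ)} {e : ℕ × ℕ}
    (h : IsCandidateList D i K) (he : e.1 < e.2) : IsCandidateList D i (addCandidate D i K e) := by
  unfold _root_.addCandidate
  split_ifs with hc
  · simp only [Bool.and_eq_true, decide_eq_true_eq, Bool.not_eq_true', List.any_eq_false,
      not_and] at hc
    obtain ⟨⟨⟨h1, h2⟩, h3⟩, h4⟩ := hc
    refine ⟨?_, ?_, ?_, ?_, by simpa using h1⟩
    · rintro p (_ | ⟨_, hp⟩)
      · exact le_rfl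
      · exact h.le p hp
    · rintro p (_ | ⟨_, hp⟩)
      · exact he
      · exact h.lt p hp
    · rw [List.map_cons, List.nodup_cons]
      refine ⟨fun hm => ?_, h.nodup⟩
      obtain ⟨p, hp, hpe⟩ := List.mem_map.1 hm
      exact h4 p hp (by rw [hpe]) (by rw [hpe])
    · intro v
      unfold degreeIn
      rw [List.filter_cons]
      split_ifs with hv
      · rw [List.length_cons]
        rcases touches_eq_true.1 hv with rfl | rfl
        · exact h2
        · exact h3
      · exact h.degree_le v
  · exact h

/-- Edges at the vertex `u` outside of `X`: if they are at least as many as the bound on the size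
of `X`, then one of them avoids `X`. -/
theorem exists_avoiding_of_degree {D i : ℕ} {K : List ((ℕ × ℕ) × ℕ)} (h : IsCandidateList D i K)
    {u : ℕ} (hu : D ≤ degreeIn K u) {X : Finset ℕ} (hX : X.card < D) (huX : u ∉ X) :
    ∃ p ∈ K, p.1.1 ∉ X ∧ p.1.2 ∉ X := by
  by_contra! hcon
  -- Different edges at `u` have different other ends, because pairs are ordered increasingly. If no
  -- edge avoided `X`, these ends would be at least `D` elements of `X`.
  let other : (ℕ × ℕ) × ℕ → ℕ := fun p => if p.1.1 = u then p.1.2 else p.1.1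
  let F := K.filter fun p => touches u p.1
  have hF : ∀ p ∈ F, p ∈ K ∧ (p.1.1 = u ∨ p.1.2 = u) := fun p hp => by
    simpa [F, List.mem_filter] using hp
  have hmap : (F.map other).Nodup := by
    refine List.Nodup.map_on ?_ ((h.nodup.of_map).sublist List.filter_sublist)
    intro p hp q hq hpq
    obtain ⟨hpK, hpu⟩ := hF p hp
    obtain ⟨hqK, hqu⟩ := hF q hq
    refine List.inj_on_of_nodup_map h.nodup hpK hqK ?_
    have h1 := h.lt p hpK
    have h2 := h.lt q hqK
    simp only [other] at hpq
    ext <;> split_ifs at hpq <;> omega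
  have hsub : (F.map other).toFinset ⊆ X := by
    intro x hx
    obtain ⟨p, hp, rfl⟩ := List.mem_map.1 (List.mem_toFinset.1 hx)
    obtain ⟨hpK, hpu⟩ := hF p hp
    simp only [other]
    split_ifs with h1
    · exact hcon p hpK (h1 ▸ huX)
    · by_contra h2
      have := hcon p hpK h2
      exact huX (by rwa [hpu.resolve_left h1] at this)
  have := Finset.card_le_card hsub
  rw [List.toFinset_card_of_nodup hmap, List.length_map] at this
  exact absurd (hu.trans this) (by omega)

/-- Fewer than `D` vertices, each on at most `D` candidates, touch at most `D * D` candidates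
altogether. -/
theorem exists_avoiding_of_length {D i : ℕ} {K : List ((ℕ × ℕ) × ℕ)} (h : IsCandidateList D i K)
    (hK : D * D < K.length) {X : Finset ℕ} (hX : X.card < D) :
    ∃ p ∈ K, p.1.1 ∉ X ∧ p.1.2 ∉ X := by
  by_contra! hcon
  have hsub : K.toFinset ⊆ X.biUnion fun x => (K.filter fun p => touches x p.1).toFinset := by
    intro p hp
    rw [List.mem_toFinset] at hp
    rw [Finset.mem_biUnion]
    by_cases h1 : p.1.1 ∈ X
    · exact ⟨_, h1, by simp [hp]⟩
    · exact ⟨_, hcon p hp h1, by simp [hp]⟩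
  have h1 := Finset.card_le_card hsub
  rw [List.toFinset_card_of_nodup h.nodup.of_map] at h1
  have h2 := Finset.card_biUnion_le_card_mul X
    (fun x => (K.filter fun p => touches x p.1).toFinset) D fun x _ =>
      (List.toFinset_card_le (K.filter fun p => touches x p.1)).trans (h.degree_le x)
  have h3 : X.card * D ≤ D * D := Nat.mul_le_mul_right _ hX.le
  omega

/-- An edge that is added represents itself. Each reason for rejecting it (full list, saturated
first or second end, already present) supplies a substitute, whose distance is at most `i` because
the search goes outwards. -/
theorem IsCandidateList.represents {D i : ℕ} {K : List ((ℕ × ℕ) × ℕ)} {e : ℕ × ℕ}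
    (h : IsCandidateList D i K) : Represents D (_root_.addCandidate D i K e) e i := by
  intro X hX h1 h2
  suffices H : ∃ p ∈ _root_.addCandidate D i K e, p.1.1 ∉ X ∧ p.1.2 ∉ X ∧ (p = (e, i) ∨ p ∈ K) by
    obtain ⟨p, hp, hp1, hp2, rfl | hpK⟩ := H
    · exact ⟨_, hp, le_rfl, hp1, hp2⟩
    · exact ⟨p, hp, h.le p hpK, hp1, hp2⟩
  suffices H : ∃ p ∈ _root_.addCandidate D i K e, p.1.1 ∉ X ∧ p.1.2 ∉ X by
    obtain ⟨p, hp, hp1, hp2⟩ := H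
    exact ⟨p, hp, hp1, hp2, eq_or_mem_of_mem_addCandidate hp⟩
  unfold _root_.addCandidate
  split_ifs with hc
  · exact ⟨(e, i), by simp, h1, h2⟩
  · simp only [Bool.and_eq_true, decide_eq_true_eq, Bool.not_eq_true', not_and_or,
      Bool.not_eq_false, List.any_eq_true] at hc
    rcases hc with ((hc | hc) | hc) | hc
    · exact exists_avoiding_of_length h (by omega) hX
    · exact exists_avoiding_of_degree h (by omega) hX h1
    · exact exists_avoiding_of_degree h (by omega) hX h2
    · obtain ⟨p, hp, hp1, hp2⟩ := hc
      exact ⟨p, hp, hp1 ▸ h1, hp2 ▸ h2⟩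

theorem foldl_addCandidate {D i : ℕ} (R : List (ℕ × ℕ)) (hR : ∀ e ∈ R, e.1 < e.2)
    (K : List ((ℕ × ℕ) × ℕ)) (hK : IsCandidateList D i K) :
    IsCandidateList D i (R.foldl (addCandidate D i) K) ∧ K ⊆ R.foldl (addCandidate D i) K ∧
      (∀ e ∈ R, Represents D (R.foldl (addCandidate D i) K) e i) ∧
      ∀ p ∈ R.foldl (addCandidate D i) K, p ∈ K ∨ p.1 ∈ R ∧ p.2 = i := by
  induction R generalizing K with
  | nil => exact ⟨hK, List.Subset.refl _, by simp, fun p hp => Or.inl hp⟩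
  | cons e R ih =>
    obtain ⟨h1, h2, h3, h4⟩ := ih (fun f hf => hR f (by simp [hf])) (addCandidate D i K e)
      (hK.addCandidate (hR e (by simp)))
    refine ⟨h1, fun p hp => h2 (subset_addCandidate D i K e hp), ?_, ?_⟩
    · rintro f (_ | ⟨_, hf⟩)
      · exact hK.represents.mono h2
      · exact h3 f hf
    · intro p hp
      rcases h4 p hp with h | ⟨h, h'⟩
      · rcases eq_or_mem_of_mem_addCandidate h with rfl | h
        · exact Or.inr ⟨by simp, rfl⟩
        · exact Or.inl h
      · exact Or.inr ⟨by simp [h], h'⟩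

/-- The third clause gives completeness of the candidates, the fourth soundness: the recorded number
is the round in which the edge was found, hence an upper bound on its distance. -/
theorem search_spec {D : ℕ} {E : List (ℕ × ℕ)} (hE : ∀ f ∈ E, f.1 < f.2) {e : ℕ × ℕ}
    (he : e.1 < e.2) (m : ℕ) :
    ((List.range m).foldl (searchStep D E) ([e], [])).1 = (expand E)^[m] [e] ∧
      IsCandidateList D m (candidates D E m e) ∧
      (∀ i < m, ∀ f ∈ (expand E)^[i] [e], Represents D (candidates D E m e) f i) ∧
      ∀ p ∈ candidates D E m e, p.1 ∈ (expand E)^[p.2] [e] := by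
  unfold candidates
  induction m with
  | zero => exact ⟨rfl, ⟨by simp, by simp, by simp, by simp [degreeIn], by simp⟩, by simp, by simp⟩
  | succ m ih =>
    obtain ⟨h1, h2, h3, h4⟩ := ih
    rw [List.range_succ, List.foldl_append, List.foldl_cons, List.foldl_nil]
    generalize (List.range m).foldl (searchStep D E) ([e], []) = s at h1 h2 h3 h4 ⊢
    have hR : ∀ f ∈ s.1, f.1 < f.2 := by
      intro f hf
      rw [h1] at hf
      cases m with
      | zero => simp only [Function.iterate_zero, id_eq, List.mem_singleton] at hf; exact hf ▸ he
      | succ m =>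
        rw [Function.iterate_succ_apply'] at hf
        exact hE f (List.mem_of_mem_filter hf)
    obtain ⟨g1, g2, g3, g4⟩ := foldl_addCandidate s.1 hR s.2 h2
    refine ⟨?_, g1.mono (by omega), ?_, ?_⟩
    · rw [Function.iterate_succ_apply', ← h1]
      rfl
    · intro i hi f hf
      rcases Nat.lt_succ_iff_lt_or_eq.1 hi with hi | rfl
      · exact (h3 i hi f hf).mono g2
      · exact g3 f (h1 ▸ hf)
    · intro p hp
      rcases g4 p hp with h | ⟨h, h'⟩
      · exact h4 p h
      · rw [h', ← h1]; exact h

/-- In contrast to the bound in `IsCandidateList`, this one needs no ordered pairs; it serves the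
analysis of the running time. -/
theorem length_candidates_le {D : ℕ} {E : List (ℕ × ℕ)} (m : ℕ) (e : ℕ × ℕ) :
    (candidates D E m e).length ≤ D * D + 1 := by
  have key : ∀ i (R : List (ℕ × ℕ)) (K : List ((ℕ × ℕ) × ℕ)), K.length ≤ D * D + 1 →
      (R.foldl (addCandidate D i) K).length ≤ D * D + 1 := by
    intro i R
    induction R with
    | nil => simp
    | cons f R ih =>
      intro K hK
      refine ih _ ?_
      unfold addCandidate
      split_ifs with hc
      · simp only [Bool.and_eq_true, decide_eq_true_eq] at hc
        simpa using hc.1.1.1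
      · exact hK
  unfold candidates
  induction m with
  | zero => simp
  | succ m ih =>
    rw [List.range_succ, List.foldl_append]
    exact key _ _ _ ih

/-- Targets can be replaced by candidates one by one. -/
theorem exists_candidates {α : Type} {D : ℕ} {cand : α → List ((ℕ × ℕ) × ℕ)} {x : α → ℕ × ℕ}
    {d : α → ℕ} (l : List α) (hrep : ∀ s ∈ l, Represents D (cand s) (x s) (d s))
    (done : List (ℕ × ℕ)) (hdisj : (done ++ l.map x).Pairwise fun e f => meets e f = false)
    (hD : 2 * (done.length + l.length) ≤ D) :
    ∃ tup, List.Forall₂ (· ∈ ·) tup (l.map cand) ∧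
      (done ++ tup.map Prod.fst).Pairwise (fun e f => meets e f = false) ∧
      (tup.map Prod.snd).sum ≤ (l.map d).sum := by
  induction l generalizing done with
  | nil => exact ⟨[], .nil, by simpa using hdisj, le_rfl⟩
  | cons s l ih =>
    -- The ends of all other edges: the replacements chosen so far and the targets not yet replaced.
    -- Leaving out the edge of `s` itself makes the bound `X.card < D` strict.
    let X := ((done ++ l.map x).flatMap fun e => [e.1, e.2]).toFinset
    have hX : X.card < D := by
      refine (List.toFinset_card_le _).trans_lt ?_
      simp only [List.length_flatMap, List.length_cons, List.length_nil, List.map_const',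
        List.sum_replicate, List.length_append, List.length_map, smul_eq_mul] at hD ⊢
      omega
    have havoid : ∀ e : ℕ × ℕ, e.1 ∉ X ∧ e.2 ∉ X ↔
        ∀ f ∈ done ++ l.map x, meets e f = false := by
      intro e
      simp only [X, List.mem_toFinset, List.mem_flatMap, List.mem_cons, List.not_mem_nil, or_false,
        not_exists, not_and, not_or, ← Bool.not_eq_true, meets, Bool.or_eq_true, touches_eq_true]
      grind
    have hxs : ∀ f ∈ done ++ l.map x, meets (x s) f = false := by
      rw [List.map_cons, List.pairwise_append, List.pairwise_cons] at hdisj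
      intro f hf
      rcases List.mem_append.1 hf with hf | hf
      · rw [meets_comm]; exact hdisj.2.2 f hf _ (by simp)
      · exact hdisj.2.1.1 f hf
    obtain ⟨p, hp, hpd, hpX⟩ := hrep s (by simp) X hX ((havoid _).2 hxs).1 ((havoid _).2 hxs).2
    have hpa := (havoid p.1).1 hpX
    obtain ⟨tup, h1, h2, h3⟩ := ih (fun s hs => hrep s (by simp [hs])) (done ++ [p.1]) (by
      rw [List.map_cons, List.pairwise_append, List.pairwise_cons] at hdisj
      rw [List.append_assoc, List.singleton_append, List.pairwise_append, List.pairwise_cons]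
      refine ⟨hdisj.1, ⟨fun f hf => hpa f (by simp only [List.mem_append]; exact Or.inr hf),
        hdisj.2.1.2⟩, fun e he f hf => ?_⟩
      rcases List.mem_cons.1 hf with rfl | hf
      · rw [meets_comm]; exact hpa e (by simp only [List.mem_append]; exact Or.inl he)
      · exact hdisj.2.2 e he f (by simp only [List.mem_cons]; exact Or.inr hf))
      (by simp only [List.length_append, List.length_cons, List.length_nil] at hD ⊢; omega)
    refine ⟨p :: tup, .cons hp h1, by simpa using h2, ?_⟩
    simp only [List.map_cons, List.sum_cons]
    omega

/-! ### Candidates and assignments -/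

section correctness

variable {n : ℕ} {G : SimpleGraph (Fin n)} {S : Finset (Sym2 (Fin n))} {E : List (ℕ × ℕ)}

/-- An edge as a pair of numbers. -/
def edgePair (e : Sym2 (Fin n)) : ℕ × ℕ := (e.inf, e.sup)

theorem edgePair_mk {u v : Fin n} (h : u ≤ v) : edgePair s(u, v) = ((u : ℕ), (v : ℕ)) := by
  simp [edgePair, h]

theorem edgePair_injective : Function.Injective (edgePair (n := n)) := by
  intro e f h
  induction e with | _ a b
  induction f with | _ c d
  rcases le_total a b with hab | hab <;> rcases le_total c d with hcd | hcd
  all_goals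
    first | rw [edgePair_mk hab] at h | rw [Sym2.eq_swap, edgePair_mk hab] at h
    first | rw [edgePair_mk hcd] at h | rw [Sym2.eq_swap (a := c), edgePair_mk hcd] at h
    simp only [Prod.mk.injEq, Fin.val_inj] at h
    obtain ⟨rfl, rfl⟩ := h
    simp [Sym2.eq_swap]

theorem touches_edgePair (v : ℕ) (e : Sym2 (Fin n)) :
    touches v (edgePair e) = true ↔ ∃ u : Fin n, (u : ℕ) = v ∧ u ∈ e := by
  induction e with | _ a b
  rcases le_total a b with hab | hab
  · rw [edgePair_mk hab]; simp; grind
  · rw [Sym2.eq_swap, edgePair_mk hab]; simp; grind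

theorem meets_edgePair (e f : Sym2 (Fin n)) :
    meets (edgePair e) (edgePair f) = true ↔ ∃ v, v ∈ e ∧ v ∈ f := by
  rw [meets_eq_true]
  simp only [touches_edgePair]
  constructor
  · rintro ⟨_, ⟨u, rfl, hu⟩, ⟨u', h, hu'⟩⟩
    exact ⟨u, hu, Fin.ext h ▸ hu'⟩
  · rintro ⟨v, h, h'⟩
    exact ⟨v, ⟨v, rfl, h⟩, v, rfl, h'⟩

theorem edgePair_lt {e : Sym2 (Fin n)} (he : e ∈ G.edgeSet) :
    (edgePair e).1 < (edgePair e).2 := by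
  induction e with | _ a b
  have hne : a ≠ b := G.ne_of_adj he
  rcases lt_or_gt_of_ne hne with h | h
  · rw [edgePair_mk h.le]; exact h
  · rw [Sym2.eq_swap, edgePair_mk h.le]; exact h

theorem exists_edge_of_mem_iterate (hE : ∀ x, x ∈ E ↔ ∃ e ∈ G.edgeSet, edgePair e = x)
    {s : Sym2 (Fin n)} (hs : s ∈ G.edgeSet) (i : ℕ) {x : ℕ × ℕ}
    (hx : x ∈ (expand E)^[i] [edgePair s]) :
    ∃ e ∈ G.edgeSet, edgePair e = x ∧ (edgeGraph G).edist s e ≤ i := by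
  induction i generalizing x with
  | zero =>
    simp only [Function.iterate_zero, id_eq, List.mem_singleton] at hx
    exact ⟨s, hs, hx.symm, by simp⟩
  | succ i ih =>
    rw [Function.iterate_succ_apply'] at hx
    simp only [expand, List.mem_filter, List.any_eq_true] at hx
    obtain ⟨hxE, y, hy, hxy⟩ := hx
    obtain ⟨e, he, rfl⟩ := (hE x).1 hxE
    obtain ⟨f, hf, rfl, hd⟩ := ih hy
    obtain ⟨v, hv, hv'⟩ := (meets_edgePair _ _).1 hxy
    have h1 : (edgeGraph G).edist f e ≤ 1 := by
      rw [SimpleGraph.edist_le_one_iff_adj_or_eq]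
      by_cases hfe : f = e
      · exact Or.inr hfe
      · exact Or.inl ⟨hf, he, hfe, v, hv', hv⟩
    refine ⟨e, he, rfl, (SimpleGraph.edist_triangle (v := f)).trans ?_⟩
    push_cast
    exact add_le_add hd h1

/-- The walk runs towards the token, so that its first step corresponds to the outermost application
of `expand`. -/
theorem mem_iterate_of_walk (hE : ∀ x, x ∈ E ↔ ∃ e ∈ G.edgeSet, edgePair e = x)
    {e s : Sym2 (Fin n)} (w : (edgeGraph G).Walk e s) :
    edgePair e ∈ (expand E)^[w.length] [edgePair s] := by
  induction w with
  | nil => simp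
  | @cons e f s h w ih =>
    rw [SimpleGraph.Walk.length_cons, Function.iterate_succ_apply']
    simp only [expand, List.mem_filter, List.any_eq_true]
    exact ⟨(hE _).2 ⟨e, h.1, rfl⟩, _, ih, (meets_edgePair _ _).2 h.2.2.2⟩

/-- A walk of length `d` shortens to a path, which visits each of the at most `n * n` unordered
pairs at most once. Hence `n * n` rounds of the search reach every finite distance. -/
theorem lt_sq_of_edist_eq {e s : Sym2 (Fin n)} {d : ℕ} (h : (edgeGraph G).edist e s = d) :
    d < n * n := by
  obtain ⟨w, hw⟩ := SimpleGraph.exists_walk_of_edist_eq_coe h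
  have h1 : d ≤ w.bypass.length := by
    have := SimpleGraph.edist_le w.bypass
    rw [h] at this
    exact_mod_cast this
  have h2 := w.bypass_isPath.length_lt
  have h3 : Fintype.card (Sym2 (Fin n)) ≤ n * n := by
    have := Fintype.card_le_of_surjective _ (Sym2.mk_surjective (α := Fin n))
    simpa using this
  omega

/-- From left to right, `exists_candidates` replaces the targets. From right to left, each candidate
is an edge whose recorded number bounds its distance, and disjointness of the tuple gives a matching
and an injective assignment. -/
theorem assignable_iff_exists_section (hE : ∀ x, x ∈ E ↔ ∃ e ∈ G.edgeSet, edgePair e = x)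
    (hS : ∀ e ∈ S, e ∈ G.edgeSet) {l : List (ℕ × ℕ)} (hl : l.Nodup)
    (hlS : ∀ x, x ∈ l ↔ ∃ e ∈ S, edgePair e = x) (b : ℕ) :
    (∃ T, IsEdgeMatching G T ∧ Assignable G S T b) ↔
      ∃ tup ∈ (l.map (candidates (2 * l.length) E (n * n))).sections,
        (tup.map Prod.fst).Pairwise (fun e f => meets e f = false) ∧
        (tup.map Prod.snd).sum ≤ b := by
  obtain ⟨sl, rfl⟩ : ∃ sl : List (Sym2 (Fin n)), sl.map edgePair = l := by
    have : l ∈ Set.range (List.map (edgePair (n := n))) := by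
      rw [Set.range_list_map]
      intro x hx
      obtain ⟨e, _, rfl⟩ := (hlS x).1 hx
      exact ⟨e, rfl⟩
    exact this
  have hsl : sl.Nodup := hl.of_map
  have hmem : ∀ e, e ∈ sl ↔ e ∈ S := by
    intro e
    rw [← List.mem_map_of_injective edgePair_injective, hlS]
    exact ⟨fun ⟨f, hf, h⟩ => edgePair_injective h ▸ hf, fun h => ⟨e, h, rfl⟩⟩
  have hSsl : S = sl.toFinset := by ext e; simp [hmem]
  have hEL : ∀ f ∈ E, f.1 < f.2 := by
    intro f hf
    obtain ⟨e, he, rfl⟩ := (hE f).1 hf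
    exact edgePair_lt he
  simp only [List.mem_sections, List.map_map, List.length_map]
  constructor
  · rintro ⟨T, hT, t, ht, hc⟩
    have hfin : ∀ e ∈ sl, ∃ d : ℕ, (edgeGraph G).edist e (t e) = d := fun e he => by
      have hle := (Finset.single_le_sum (f := fun e => (edgeGraph G).edist e (t e))
        (fun _ _ => zero_le) ((hmem e).1 he)).trans hc
      obtain ⟨d, hd⟩ := ENat.ne_top_iff_exists.1 (ne_top_of_le_ne_top (ENat.natCast_ne_top b) hle)
      exact ⟨d, hd.symm⟩
    have hd : ∀ e ∈ sl, (edgeGraph G).edist e (t e) = (((edgeGraph G).edist e (t e)).toNat : ℕ) :=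
      fun e he => by
        obtain ⟨d, hd⟩ := hfin e he
        rw [hd, ENat.toNat_natCast]
    obtain ⟨tup, h1, h2, h3⟩ := exists_candidates (D := 2 * sl.length)
      (cand := candidates (2 * sl.length) E (n * n) ∘ edgePair) (x := fun e => edgePair (t e))
      (d := fun e => ((edgeGraph G).edist e (t e)).toNat) sl (fun e he => by
        have hlt := lt_sq_of_edist_eq (hd e he)
        refine (search_spec hEL (edgePair_lt (hS e ((hmem e).1 he))) (n * n)).2.2.1 _ hlt _ ?_
        have hd' := hd e he
        rw [SimpleGraph.edist_comm] at hd'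
        obtain ⟨w, hw⟩ := SimpleGraph.exists_walk_of_edist_eq_coe hd'
        rw [SimpleGraph.edist_comm, ← hw]
        exact mem_iterate_of_walk hE w) []
      (by
        rw [List.nil_append, List.pairwise_map]
        refine hsl.imp_of_mem fun {e f} he hf hef => ?_
        rw [← Bool.not_eq_true, meets_edgePair]
        rintro ⟨v, hv, hv'⟩
        exact hT.2 (t e) (ht.mapsTo ((hmem e).1 he)) (t f) (ht.mapsTo ((hmem f).1 hf))
          (fun h => hef (ht.injOn ((hmem e).1 he) ((hmem f).1 hf) h)) v hv hv') (by simp)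
    refine ⟨tup, h1, by simpa using h2, h3.trans ?_⟩
    have : (((sl.map fun e => ((edgeGraph G).edist e (t e)).toNat).sum : ℕ) : ℕ∞) ≤ b := by
      rw [← List.sum_toFinset _ hsl, ← hSsl]
      push_cast
      refine le_trans (le_of_eq ?_) hc
      exact Finset.sum_congr rfl fun e he => (hd e ((hmem e).2 he)).symm
    exact_mod_cast this
  · rintro ⟨tup, h1, h2, h3⟩
    obtain ⟨t, ht1, ht2, ht3⟩ : ∃ t : Sym2 (Fin n) → Sym2 (Fin n), (∀ e ∈ sl, t e ∈ G.edgeSet) ∧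
        tup.map Prod.fst = sl.map (fun e => edgePair (t e)) ∧
        (sl.map fun e => (edgeGraph G).edist e (t e)).sum ≤ ((tup.map Prod.snd).sum : ℕ) := by
      have hsub : ∀ e ∈ sl, e ∈ G.edgeSet := fun e he => hS e ((hmem e).1 he)
      -- The degree bound has to stay fixed while `sl` shrinks in the induction.
      generalize 2 * sl.length = D at h1
      clear hmem hSsl hlS hl h2 h3
      induction sl generalizing tup with
      | nil =>
        rw [List.map_nil, List.forall₂_nil_right_iff] at h1
        subst h1
        exact ⟨id, by simp, rfl, by simp⟩
      | cons e sl ih =>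
        rw [List.map_cons, List.forall₂_cons_right_iff] at h1
        obtain ⟨p, tup, hp, h1, rfl⟩ := h1
        rw [List.nodup_cons] at hsl
        obtain ⟨t, ht1, ht2, ht3⟩ := ih hsl.2 tup (fun e he => hsub e (by simp [he])) h1
        have he := hsub e (by simp)
        obtain ⟨f, hf, hfp, hd⟩ := exists_edge_of_mem_iterate hE he p.2
          ((search_spec hEL (edgePair_lt he) (n * n)).2.2.2 p hp)
        have hne : ∀ g ∈ sl, Function.update t e f g = t g := fun g hg =>
          Function.update_of_ne (fun h : g = e => hsl.1 (h ▸ hg)) _ _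
        refine ⟨Function.update t e f, ?_, ?_, ?_⟩
        · rintro g (_ | ⟨_, hg⟩)
          · simpa using hf
          · rw [hne g hg]; exact ht1 g hg
        · rw [List.map_cons, List.map_cons, ht2, Function.update_self, hfp]
          congr 1
          exact List.map_congr_left fun g hg => by rw [hne g hg]
        · rw [List.map_cons, List.map_cons, List.sum_cons, List.sum_cons, Function.update_self]
          have : (sl.map fun g => (edgeGraph G).edist g (Function.update t e f g)) =
              sl.map fun g => (edgeGraph G).edist g (t g) :=
            List.map_congr_left fun g hg => by rw [hne g hg]
          rw [this]
          push_cast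
          push_cast at ht3
          exact add_le_add hd ht3
    rw [ht2, List.pairwise_map] at h2
    have hdisj : ∀ e ∈ sl, ∀ f ∈ sl, e ≠ f → meets (edgePair (t e)) (edgePair (t f)) = false :=
      fun e he f hf hef => by
        have : Std.Symm fun a b => meets (edgePair (t a)) (edgePair (t b)) = false :=
          ⟨fun _ _ h => by rwa [meets_comm]⟩
        exact h2.forall he hf hef
    -- Equal targets would be disjoint from themselves, but every edge meets itself.
    have hinj : Set.InjOn t S := by
      intro e he f hf hef
      by_contra hne
      have := hdisj e ((hmem e).2 he) f ((hmem f).2 hf) hne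
      rw [hef, meets_self] at this
      exact absurd this (by simp)
    refine ⟨S.image t, ⟨?_, ?_⟩, t, ?_, ?_⟩
    · intro e he
      obtain ⟨f, hf, rfl⟩ := Finset.mem_image.1 he
      exact ht1 f ((hmem f).2 hf)
    · intro e he f hf hef v hv hv'
      obtain ⟨e, he', rfl⟩ := Finset.mem_image.1 he
      obtain ⟨f, hf', rfl⟩ := Finset.mem_image.1 hf
      have := hdisj e ((hmem e).2 he') f ((hmem f).2 hf') fun h => hef (h ▸ rfl)
      rw [← Bool.not_eq_true, meets_edgePair] at this
      exact this ⟨v, hv, hv'⟩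
    · rw [Finset.coe_image]
      exact hinj.bijOn_image
    · rw [hSsl, List.sum_toFinset _ hsl]
      exact ht3.trans (by exact_mod_cast h3)

end correctness

/-! ### The decision procedure on words -/

/-- Read a number in unary: `(false, k)` if there are `k` leading ones and a zero. -/
def readUnary (w : List Bool) : Bool × ℕ :=
  w.foldl (fun s b => if b && s.1 then (true, s.2 + 1) else (false, s.2)) (true, 0)

/-- The entry of an `n × n` matrix that starts at the position `o` of the word `y`. -/
def bitAt (n o : ℕ) (y : List Bool) (u v : ℕ) : Bool := y.getD (o + (u * n + v)) false

/-- The edges whose bit above the diagonal is set. -/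
def edgeList (n o : ℕ) (y : List Bool) : List (ℕ × ℕ) :=
  (List.range n).flatMap fun u =>
    ((List.range n).filter fun v => decide (u < v) && bitAt n o y u v).map fun v => (u, v)

/-- The word `y` consists of the adjacency matrix of a graph on `n` vertices, that of a set of `k`
edges, and a number in binary. -/
def isInstance (k n : ℕ) (y : List Bool) : Bool :=
  decide (n * n + n * n ≤ y.length) && (y.drop (n * n + n * n)).reverse.headD true &&
  (List.range n).all (fun u => !bitAt n 0 y u u && (List.range n).all fun v =>
    (!bitAt n 0 y u v || bitAt n 0 y v u) && (!bitAt n (n * n) y u v || bitAt n (n * n) y v u) &&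
    (!bitAt n (n * n) y u v || bitAt n 0 y u v)) &&
  decide ((edgeList n (n * n) y).length = k)

/-- The minimum of `cap` and the number with the binary digits `l`. -/
def cappedValue (cap : ℕ) (l : List Bool) : ℕ :=
  l.foldr (fun b v => if decide ((if b then 1 else 0) + (v + v) ≤ cap) then
    (if b then 1 else 0) + (v + v) else cap) 0

/-- The edges in a tuple are pairwise disjoint. -/
def isDisjointTuple (t : List ((ℕ × ℕ) × ℕ)) : Bool :=
  (t.foldl (fun s p => (s.1 && s.2.all fun e => !meets p.1 e, p.1 :: s.2))
    (true, ([] : List (ℕ × ℕ)))).1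

/-- The tuple is a matching whose cost is at most the number with the binary digits `l`. -/
def isSolution (l : List Bool) (t : List ((ℕ × ℕ) × ℕ)) : Bool :=
  isDisjointTuple t && decide ((t.map Prod.snd).sum ≤ cappedValue (t.map Prod.snd).sum l)

/-- The candidates of all tokens. -/
def candidateLists (k n : ℕ) (y : List Bool) : List (List ((ℕ × ℕ) × ℕ)) :=
  (edgeList n (n * n) y).map fun e => candidates (2 * k) (edgeList n 0 y) (n * n) e

/-- Some choice of candidates is a solution. -/
def hasSolution (l : List Bool) (L : List (List ((ℕ × ℕ) × ℕ))) : Bool :=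
  L.sections.any fun t => isSolution l t

/-- The parameter, the number of vertices and the rest of an instance word. -/
def parse (w : List Bool) : Bool × ℕ × ℕ × List Bool :=
  ((readUnary (w.drop ((readUnary w).2 + 1))).1, (readUnary w).2,
    (readUnary (w.drop ((readUnary w).2 + 1))).2,
    (w.drop ((readUnary w).2 + 1)).drop ((readUnary (w.drop ((readUnary w).2 + 1))).2 + 1))

/-- The decision procedure after parsing. -/
def solveParsed (p : Bool × ℕ × ℕ × List Bool) : Bool :=
  (!p.1 && isInstance p.2.1 p.2.2.1 p.2.2.2) &&
    hasSolution (p.2.2.2.drop (p.2.2.1 * p.2.2.1 + p.2.2.1 * p.2.2.1))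
      -- The guard matters for the running time: on a malformed word the number of lists need not be
      -- `k`, and the number of choices would not be bounded in terms of `k`.
      (if (!p.1 && isInstance p.2.1 p.2.2.1 p.2.2.2) = true then
        candidateLists p.2.1 p.2.2.1 p.2.2.2 else [])

/-- The decision procedure. -/
def solve (w : List Bool) : Bool := solveParsed (parse w)

/-! ### Correctness -/

theorem readUnary_eq (k : ℕ) (x : List Bool) :
    readUnary (List.replicate k true ++ false :: x) = (false, k) := by
  unfold readUnary
  have h0 : ∀ (x : List Bool) m, x.foldl (fun (s : Bool × ℕ) b =>
      if b && s.1 then (true, s.2 + 1) else (false, s.2)) (false, m) = (false, m) := by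
    intro x m
    induction x with
    | nil => rfl
    | cons b x ih => simpa using ih
  have h1 : ∀ k m, (List.replicate k true ++ false :: x).foldl (fun (s : Bool × ℕ) b =>
      if b && s.1 then (true, s.2 + 1) else (false, s.2)) (true, m) = (false, m + k) := by
    intro k
    induction k with
    | zero => intro m; exact h0 x m
    | succ k ih =>
      intro m
      rw [List.replicate_succ, List.cons_append, List.foldl_cons]
      simp only [Bool.and_self, if_true]
      rw [ih, add_right_comm, add_assoc]
  simpa using h1 k 0

theorem drop_unary (k : ℕ) (x : List Bool) :
    (List.replicate k true ++ false :: x).drop (k + 1) = x := by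
  rw [← List.singleton_append, ← List.append_assoc]
  exact List.drop_left' (by simp)

theorem eq_of_readUnary {w : List Bool} (h : (readUnary w).1 = false) :
    w = List.replicate (readUnary w).2 true ++ false :: w.drop ((readUnary w).2 + 1) := by
  suffices ∃ k x, w = List.replicate k true ++ false :: x by
    obtain ⟨k, x, rfl⟩ := this
    rw [readUnary_eq, drop_unary]
  unfold readUnary at h
  revert h
  generalize 0 = m
  induction w generalizing m with
  | nil => simp
  | cons b w ih =>
    intro h
    cases b with
    | false => exact ⟨0, w, rfl⟩
    | true =>
      obtain ⟨k, x, rfl⟩ := ih (m + 1) (by simpa using h)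
      exact ⟨k + 1, x, rfl⟩

/-- The number with the binary digits `l`. -/
def binaryValue : List Bool → ℕ
  | [] => 0
  | b :: l => Nat.bit b (binaryValue l)

/-- Cutting off at `cap` after every doubling gives the minimum of `cap` and the value, which
suffices for comparison with `cap`. The value itself may be exponential in the length of the word,
too large for a unary tree. -/
theorem le_cappedValue_iff (cap : ℕ) (l : List Bool) :
    cap ≤ cappedValue cap l ↔ cap ≤ binaryValue l := by
  suffices cappedValue cap l = min (binaryValue l) cap by rw [this, le_min_iff]; simp
  induction l with
  | nil => simp [cappedValue, binaryValue]
  | cons b l ih =>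
    have : cappedValue cap (b :: l) = if decide ((if b then 1 else 0) +
        (cappedValue cap l + cappedValue cap l) ≤ cap) then
        (if b then 1 else 0) + (cappedValue cap l + cappedValue cap l) else cap := rfl
    rw [this, ih, binaryValue, Nat.bit_val]
    cases b <;> simp <;> split_ifs <;> omega

theorem binaryValue_bits (b : ℕ) : binaryValue b.bits = b := by
  induction b using Nat.binaryRec' with
  | zero => simp [binaryValue]
  | bit b n h ih => rw [Nat.bits_append_bit n b h, binaryValue, ih]

/-- The hypothesis says that the most significant digit is not zero; the default `true` admits the
empty word, which represents `0`. -/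
theorem bits_binaryValue {l : List Bool} (h : l.reverse.headD true = true) :
    (binaryValue l).bits = l := by
  induction l with
  | nil => simp [binaryValue]
  | cons b l ih =>
    rw [List.reverse_cons] at h
    rw [binaryValue]
    cases l with
    | nil =>
      have : b = true := by simpa using h
      subst this
      simp [binaryValue]
    | cons c l =>
      have h' : (c :: l).reverse.headD true = true := by
        rw [List.headD_eq_head?_getD, List.head?_append] at h
        rw [List.headD_eq_head?_getD]
        cases hh : (c :: l).reverse.head? with
        | none => rfl
        | some d => rw [hh] at h; exact h
      rw [Nat.bits_append_bit, ih h']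
      intro h0
      have := ih h'
      rw [h0, Nat.zero_bits] at this
      exact absurd this (by simp)

theorem headD_reverse_bits (b : ℕ) : b.bits.reverse.headD true = true := by
  induction b using Nat.binaryRec' with
  | zero => simp
  | bit b n h ih =>
    rw [Nat.bits_append_bit n b h, List.reverse_cons, List.headD_eq_head?_getD, List.head?_append]
    rw [List.headD_eq_head?_getD] at ih
    cases hn : n.bits.reverse.head? with
    | none =>
      have h0 : n.bits = [] := by simpa using hn
      have hn0 : n = 0 := by rw [← binaryValue_bits n, h0]; rfl
      simp [h hn0]
    | some d => simpa [hn] using ih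

theorem isDisjointTuple_iff (t : List ((ℕ × ℕ) × ℕ)) : isDisjointTuple t = true ↔
    (t.map Prod.fst).Pairwise fun e f => meets e f = false := by
  have key : ∀ (t : List ((ℕ × ℕ) × ℕ)) (ok : Bool) (seen : List (ℕ × ℕ)),
      (t.foldl (fun s p => (s.1 && s.2.all fun e => !meets p.1 e, p.1 :: s.2)) (ok, seen)).1 = true ↔
        ok = true ∧ (∀ p ∈ t, ∀ e ∈ seen, meets p.1 e = false) ∧
        (t.map Prod.fst).Pairwise fun e f => meets e f = false := by
    intro t
    induction t with
    | nil => simp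
    | cons p t ih =>
      intro ok seen
      rw [List.foldl_cons, ih]
      simp only [Bool.and_eq_true, List.all_eq_true, Bool.not_eq_true', List.mem_cons,
        forall_eq_or_imp, List.map_cons, List.pairwise_cons, List.mem_map]
      constructor
      · rintro ⟨⟨h1, h2⟩, h3, h4⟩
        refine ⟨h1, ⟨h2, fun q hq => (h3 q hq).2⟩, ?_, h4⟩
        rintro _ ⟨q, hq, rfl⟩
        rw [meets_comm]
        exact (h3 q hq).1
      · rintro ⟨h1, ⟨h2, h3⟩, h4, h5⟩
        refine ⟨⟨h1, h2⟩, fun q hq => ⟨?_, h3 q hq⟩, h5⟩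
        rw [meets_comm]
        exact h4 _ ⟨q, hq, rfl⟩
  unfold isDisjointTuple
  rw [key]
  simp

theorem length_flatMap_eq_mul {α β : Type} {n : ℕ} {f : α → List β} (hf : ∀ a, (f a).length = n)
    (l : List α) : (l.flatMap f).length = l.length * n := by
  simp [List.length_flatMap, hf]

theorem getD_flatMap {α β : Type} {n : ℕ} {f : α → List β} (hf : ∀ a, (f a).length = n)
    (l : List α) {u v : ℕ} (hu : u < l.length) (hv : v < n) (d : β) :
    (l.flatMap f).getD (u * n + v) d = (f l[u]).getD v d := by
  induction l generalizing u with
  | nil => simp at hu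
  | cons a l ih =>
    rw [List.flatMap_cons]
    cases u with
    | zero =>
      rw [zero_mul, zero_add, List.getD_append _ _ _ _ (by rw [hf]; exact hv)]
      rfl
    | succ u =>
      rw [List.getD_append_right _ _ _ _ (by rw [hf, Nat.add_mul]; omega), hf,
        show (u + 1) * n + v - n = u * n + v by rw [Nat.add_mul]; omega,
        ih (by simpa using hu)]
      rfl

theorem length_matrixBits {n : ℕ} (R : Fin n → Fin n → Prop) : (matrixBits R).length = n * n := by
  unfold matrixBits
  rw [length_flatMap_eq_mul (n := n) (by simp), List.length_finRange]

theorem getD_matrixBits {n : ℕ} (R : Fin n → Fin n → Prop) (u v : Fin n) :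
    (matrixBits R).getD (u * n + v) false = true ↔ R u v := by
  unfold matrixBits
  rw [getD_flatMap (n := n) (by simp) _ (by simp) v.2]
  simp

/-- Inverts the encoding: the position `i` is the entry in row `i / n` and column `i % n`. -/
theorem eq_matrixBits {n : ℕ} {z : List Bool} (hz : z.length = n * n) :
    z = matrixBits fun u v : Fin n => z.getD (u * n + v) false = true := by
  refine List.ext_getElem (by rw [hz, length_matrixBits]) fun i h1 h2 => ?_
  rw [hz] at h1
  have hn : 0 < n := by
    rcases Nat.eq_zero_or_pos n with rfl | h
    · simp at h1
    · exact h
  have hi : i / n * n + i % n = i := Nat.div_add_mod' i n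
  have := getD_matrixBits (fun u v : Fin n => z.getD (u * n + v) false = true)
    ⟨i / n, Nat.div_lt_of_lt_mul h1⟩ ⟨i % n, Nat.mod_lt i hn⟩
  simp only [hi] at this
  rw [List.getD_eq_getElem _ _ h2, List.getD_eq_getElem _ _ (by omega)] at this
  exact (Bool.eq_iff_iff.2 this).symm

/-! ### Edge lists read off the matrices -/

section edgeList

variable {n o : ℕ} {y : List Bool} {P : Sym2 (Fin n) → Prop}

/-- Reading only above the diagonal lists every edge once, as an increasing pair. Nothing is lost,
since `P` depends on the unordered pair and fails on the diagonal. -/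
theorem mem_edgeList (hy : ∀ u v : Fin n, bitAt n o y u v = true ↔ P s(u, v))
    (hP : ∀ u, ¬P s(u, u)) (x : ℕ × ℕ) : x ∈ edgeList n o y ↔ ∃ e, P e ∧ edgePair e = x := by
  obtain ⟨a, b⟩ := x
  simp only [edgeList, List.mem_flatMap, List.mem_range, List.mem_map, List.mem_filter,
    Bool.and_eq_true, decide_eq_true_eq, Prod.mk.injEq]
  constructor
  · rintro ⟨u, hu, v, ⟨hv, huv, h⟩, rfl, rfl⟩
    refine ⟨s(⟨u, hu⟩, ⟨v, hv⟩), (hy ⟨u, hu⟩ ⟨v, hv⟩).1 h, edgePair_mk ?_⟩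
    exact huv.le
  · rintro ⟨e, he, h⟩
    induction e with | _ u v
    have hne : u ≠ v := fun h => hP v (h ▸ he)
    rcases lt_or_gt_of_ne hne with huv | huv
    · rw [edgePair_mk huv.le] at h
      exact ⟨u, u.2, v, ⟨v.2, huv, (hy u v).2 he⟩, Prod.mk.inj h⟩
    · rw [Sym2.eq_swap] at he h
      rw [edgePair_mk huv.le] at h
      exact ⟨v, v.2, u, ⟨u.2, huv, (hy v u).2 he⟩, Prod.mk.inj h⟩

theorem nodup_edgeList (n o : ℕ) (y : List Bool) : (edgeList n o y).Nodup := by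
  unfold edgeList
  rw [List.nodup_flatMap]
  refine ⟨fun u _ => (List.nodup_range.filter _).map fun v v' h => (Prod.mk.inj h).2, ?_⟩
  refine List.nodup_range.imp fun {u u'} h x hx hx' => h ?_
  obtain ⟨v, _, rfl⟩ := List.mem_map.1 hx
  obtain ⟨v', _, h'⟩ := List.mem_map.1 hx'
  exact (Prod.mk.inj h').1.symm

theorem length_edgeList {S : Finset (Sym2 (Fin n))}
    (h : ∀ x, x ∈ edgeList n o y ↔ ∃ e ∈ S, edgePair e = x) :
    (edgeList n o y).length = S.card := by
  rw [← List.toFinset_card_of_nodup (nodup_edgeList n o y),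
    ← Finset.card_image_of_injective S edgePair_injective]
  congr 1
  ext x
  rw [List.mem_toFinset, h, Finset.mem_image]

end edgeList

/-- The part of the representation of an instance after the number of vertices. -/
noncomputable def MatchingDiscoveryInstance.body (I : MatchingDiscoveryInstance) : List Bool :=
  matrixBits I.G.Adj ++ matrixBits (fun u v => s(u, v) ∈ I.S) ++ I.b.bits

/-! ### The procedure on words that encode instances -/

section

variable (I : MatchingDiscoveryInstance)

theorem bitAt_body_graph (u v : Fin I.n) :
    bitAt I.n 0 I.body u v = true ↔ s(u, v) ∈ I.G.edgeSet := by
  have hlt : (u : ℕ) * I.n + v < I.n * I.n := by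
    have := Nat.mul_le_mul_right I.n (Nat.succ_le_of_lt u.2)
    have := v.2
    rw [Nat.succ_mul] at *
    omega
  unfold bitAt MatchingDiscoveryInstance.body
  rw [zero_add, List.append_assoc, List.getD_append _ _ _ _ (by rw [length_matrixBits]; exact hlt),
    getD_matrixBits]
  rfl

theorem bitAt_body_tokens (u v : Fin I.n) :
    bitAt I.n (I.n * I.n) I.body u v = true ↔ s(u, v) ∈ I.S := by
  have hlt : (u : ℕ) * I.n + v < I.n * I.n := by
    have := Nat.mul_le_mul_right I.n (Nat.succ_le_of_lt u.2)
    have := v.2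
    rw [Nat.succ_mul] at *
    omega
  unfold bitAt MatchingDiscoveryInstance.body
  rw [List.append_assoc, List.getD_append_right _ _ _ _ (by rw [length_matrixBits]; omega),
    length_matrixBits, Nat.add_sub_cancel_left,
    List.getD_append _ _ _ _ (by rw [length_matrixBits]; exact hlt), getD_matrixBits]

theorem drop_body : I.body.drop (I.n * I.n + I.n * I.n) = I.b.bits := by
  unfold MatchingDiscoveryInstance.body
  exact List.drop_left' (by simp [length_matrixBits])

theorem mem_edgeList_graph (x : ℕ × ℕ) :
    x ∈ edgeList I.n 0 I.body ↔ ∃ e ∈ I.G.edgeSet, edgePair e = x :=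
  mem_edgeList (P := (· ∈ I.G.edgeSet)) (bitAt_body_graph I)
    (fun _ h => I.G.irrefl h) x

theorem mem_edgeList_tokens (x : ℕ × ℕ) :
    x ∈ edgeList I.n (I.n * I.n) I.body ↔ ∃ e ∈ I.S, edgePair e = x :=
  mem_edgeList (P := (· ∈ I.S)) (bitAt_body_tokens I)
    (fun _ h => I.G.irrefl (I.S_subset _ h)) x

theorem isInstance_body (k : ℕ) : isInstance k I.n I.body = true ↔ I.S.card = k := by
  have hlen : I.n * I.n + I.n * I.n ≤ I.body.length := by
    simp [MatchingDiscoveryInstance.body, length_matrixBits]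
  have hall : (List.range I.n).all (fun u => !bitAt I.n 0 I.body u u && (List.range I.n).all fun v =>
      (!bitAt I.n 0 I.body u v || bitAt I.n 0 I.body v u) &&
      (!bitAt I.n (I.n * I.n) I.body u v || bitAt I.n (I.n * I.n) I.body v u) &&
      (!bitAt I.n (I.n * I.n) I.body u v || bitAt I.n 0 I.body u v)) = true := by
    simp only [List.all_eq_true, List.mem_range, Bool.and_eq_true, Bool.not_eq_true',
      Bool.or_eq_true, ← Bool.not_eq_true]
    refine fun u hu => ⟨fun h => I.G.irrefl ((bitAt_body_graph I ⟨u, hu⟩ ⟨u, hu⟩).1 h),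
      fun v hv => ?_⟩
    have e2 := bitAt_body_graph I ⟨u, hu⟩ ⟨v, hv⟩
    have e3 := bitAt_body_graph I ⟨v, hv⟩ ⟨u, hu⟩
    have e4 := bitAt_body_tokens I ⟨u, hu⟩ ⟨v, hv⟩
    have e5 := bitAt_body_tokens I ⟨v, hv⟩ ⟨u, hu⟩
    rw [Sym2.eq_swap] at e3 e5
    simp only at e2 e3 e4 e5
    have := I.S_subset s(⟨u, hu⟩, ⟨v, hv⟩)
    rw [e2, e3, e4, e5]
    tauto
  unfold isInstance
  rw [drop_body, headD_reverse_bits, hall, decide_eq_true hlen,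
    length_edgeList (mem_edgeList_tokens I)]
  simp

theorem hasSolution_body : hasSolution I.b.bits (candidateLists I.S.card I.n I.body) = true ↔
    MatchingDiscoverable I.G I.S I.b := by
  have hlen := length_edgeList (mem_edgeList_tokens I)
  have h := assignable_iff_exists_section (mem_edgeList_graph I) I.S_subset
    (nodup_edgeList I.n (I.n * I.n) I.body) (mem_edgeList_tokens I) I.b
  rw [matchingDiscoverable_iff I.S_subset, h, hlen]
  unfold hasSolution candidateLists isSolution
  simp only [List.any_eq_true, Bool.and_eq_true, isDisjointTuple_iff, decide_eq_true_eq,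
    le_cappedValue_iff, binaryValue_bits]

theorem solve_encode (k : ℕ) : solve (instanceWord I.encode k) = true ↔
    I.S.card = k ∧ MatchingDiscoverable I.G I.S I.b := by
  have hparse : parse (instanceWord I.encode k) = (false, k, I.n, I.body) := by
    have hdrop : (instanceWord I.encode k).drop (k + 1) = I.encode := drop_unary k _
    have henc : I.encode = List.replicate I.n true ++ false :: I.body := rfl
    have h1 : readUnary (instanceWord I.encode k) = (false, k) := readUnary_eq k _
    unfold parse
    rw [h1]
    dsimp only
    rw [hdrop, henc, readUnary_eq]
    dsimp only
    rw [drop_unary]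
  unfold solve
  rw [hparse]
  unfold solveParsed
  dsimp only
  rw [Bool.not_false, Bool.true_and, Bool.and_eq_true, drop_body]
  constructor
  · rintro ⟨h1, h2⟩
    rw [if_pos h1] at h2
    have hk := (isInstance_body I k).1 h1
    subst hk
    exact ⟨rfl, (hasSolution_body I).1 h2⟩
  · rintro ⟨rfl, h⟩
    have h1 := (isInstance_body I _).2 rfl
    rw [if_pos h1]
    exact ⟨h1, (hasSolution_body I).2 h⟩

end

theorem getD_take_mul_add {n : ℕ} (z : List Bool) (u v : Fin n) :
    (z.take (n * n)).getD (u * n + v) false = z.getD (u * n + v) false := by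
  have := Nat.mul_le_mul_right n (Nat.succ_le_of_lt u.2)
  have := v.2
  rw [Nat.succ_mul] at *
  rw [List.getD_eq_getElem?_getD, List.getD_eq_getElem?_getD, List.getElem?_take_of_lt (by omega)]

/-- The syntactic checks are what is needed to rebuild the graph, the tokens and the budget from the
word, so acceptance of words that encode nothing is excluded. -/
theorem exists_instance_of_isInstance {k n : ℕ} {y : List Bool} (h : isInstance k n y = true) :
    ∃ I : MatchingDiscoveryInstance, I.encode = List.replicate n true ++ false :: y := by
  unfold isInstance at h
  simp only [Bool.and_eq_true, decide_eq_true_eq, List.all_eq_true, List.mem_range,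
    Bool.not_eq_true', Bool.or_eq_true] at h
  obtain ⟨⟨⟨hlen, hb⟩, hall⟩, -⟩ := h
  have hsymm : ∀ u v : Fin n, bitAt n 0 y u v = true → bitAt n 0 y v u = true := fun u v h =>
    (((hall u u.2).2 v v.2).1.1.resolve_left (by simp [h]))
  have hsymm' : ∀ u v : Fin n, bitAt n (n * n) y u v = true → bitAt n (n * n) y v u = true :=
    fun u v h => (((hall u u.2).2 v v.2).1.2.resolve_left (by simp [h]))
  have hsub : ∀ u v : Fin n, bitAt n (n * n) y u v = true → bitAt n 0 y u v = true :=
    fun u v h => (((hall u u.2).2 v v.2).2.resolve_left (by simp [h]))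
  let G : SimpleGraph (Fin n) :=
    { Adj := fun u v => bitAt n 0 y u v = true
      symm := ⟨hsymm⟩
      loopless := ⟨fun u h => by rw [(hall u u.2).1] at h; exact absurd h (by simp)⟩ }
  have hlift : Std.Symm fun u v : Fin n => bitAt n (n * n) y u v = true := ⟨hsymm'⟩
  let S : Finset (Sym2 (Fin n)) := by
    classical exact Finset.univ.filter fun e =>
      e ∈ Sym2.fromRel (r := fun u v : Fin n => bitAt n (n * n) y u v = true) hlift
  have hS : ∀ u v : Fin n, s(u, v) ∈ S ↔ bitAt n (n * n) y u v = true := by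
    intro u v
    simp [S]
  refine ⟨⟨n, G, S, ?_, binaryValue (y.drop (n * n + n * n))⟩, ?_⟩
  · intro e
    induction e with | _ u v
    intro he
    exact hsub u v ((hS u v).1 he)
  · unfold MatchingDiscoveryInstance.encode
    dsimp only
    congr 2
    rw [bits_binaryValue hb]
    have h1 : matrixBits G.Adj = y.take (n * n) := by
      rw [eq_matrixBits (n := n) (z := y.take (n * n)) (by rw [List.length_take]; omega)]
      congr 1
      funext u v
      change (bitAt n 0 y u v = true) = _
      rw [getD_take_mul_add]
      simp [bitAt]
    have h2 : matrixBits (fun u v => s(u, v) ∈ S) = (y.drop (n * n)).take (n * n) := by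
      rw [eq_matrixBits (n := n) (z := (y.drop (n * n)).take (n * n)) (by
        rw [List.length_take, List.length_drop]; omega)]
      congr 1
      funext u v
      rw [getD_take_mul_add, hS]
      simp [bitAt, List.getD_eq_getElem?_getD, List.getElem?_drop]
    rw [h1, h2, List.append_assoc, ← List.drop_drop, List.take_append_drop, List.take_append_drop]

theorem mem_matchingDiscoverySliding_iff (x : List Bool) (k : ℕ) :
    solve (instanceWord x k) = true ↔ (x, k) ∈ matchingDiscoverySliding := by
  constructor
  · intro h
    have h1 : readUnary (instanceWord x k) = (false, k) := readUnary_eq k _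
    have hdrop : (instanceWord x k).drop (k + 1) = x := drop_unary k x
    have h' := h
    unfold solve solveParsed parse at h'
    rw [h1] at h'
    dsimp only at h'
    rw [hdrop, Bool.and_eq_true] at h'
    have h'' := h'.1
    rw [Bool.and_eq_true, Bool.not_eq_true'] at h''
    obtain ⟨I, hI⟩ := exists_instance_of_isInstance h''.2
    rw [← eq_of_readUnary h''.1] at hI
    subst hI
    obtain ⟨h1, h2⟩ := (solve_encode I k).1 h
    exact ⟨I, rfl, h1, h2⟩
  · rintro ⟨I, rfl, h⟩
    exact (solve_encode I k).2 h

/-! ### The running time -/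

section closure

variable {X : Type} [Enc X]

@[fun_prop]
theorem PolyTime.sum {l : X → List ℕ} (hl : PolyTime l) : PolyTime fun x => (l x).sum := by
  obtain ⟨q, hq, hb⟩ := hl.size_bound
  have h := PolyTime.foldl (f := l) (g := fun _ => 0) (h := fun _ b a => b + a) hl
    (by fun_prop) (by fun_prop) hq (fun x b a ha => by
      have := (esize_le_of_mem ha).trans (hb x)
      simp only [esize_nat] at *
      omega)
  simpa only [← List.sum_eq_foldl] using h

theorem sections_eq_foldl {A : Type} (L : List (List A)) : L.sections =
    L.reverse.foldl (fun b l => b.flatMap fun s => l.map fun a => a :: s) [[]] := by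
  rw [List.foldl_reverse]
  induction L with
  | nil => rfl
  | cons l L ih => rw [List.sections, ih]; rfl

theorem length_sections {A : Type} (L : List (List A)) : L.sections.length = (L.map List.length).prod := by
  induction L with
  | nil => rfl
  | cons l L ih => simp [List.sections, List.length_flatMap, ih, mul_comm]

theorem esize_le_of_mem_sections {A : Type} [Enc A] {L : List (List A)} {t : List A} (ht : t ∈ L.sections) :
    esize t ≤ esize L := by
  rw [List.mem_sections] at ht
  induction ht with
  | nil => exact le_rfl
  | cons ha _ ih =>
    have := esize_le_of_mem ha
    rw [esize_cons, esize_cons]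
    omega

/-- The time for the computation of all choices is polynomial in the number of the choices. -/
theorem polyTimeIn_sections {A : Type} [Enc A] :
    PolyTimeIn (fun L : List (List A) => (L.map fun l => l.length + 1).prod) List.sections := by
  rw [show (List.sections : List (List A) → _) = _ from funext sections_eq_foldl]
  refine PolyTimeIn.foldl_of_bound (f := fun L : List (List A) => L.reverse) (g := fun _ => [[]])
    (h := fun _ (b : List (List A)) (l : List A) => b.flatMap fun s => l.map fun a => a :: s)
    (PolyTime.polyTimeIn (by fun_prop) _) (PolyTime.polyTimeIn (by fun_prop) _) (by fun_prop)
    (q := fun n => n * (n + 1) + 1)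
    ((PolyBdd.id.mul (PolyBdd.id.add (PolyBdd.const 1))).add (PolyBdd.const 1)) fun L l hl => ?_
  have hl' := sections_eq_foldl l.reverse
  rw [List.reverse_reverse] at hl'
  rw [← hl']
  have hsub : l.reverse.Sublist L := by
    have := hl.sublist.reverse
    rwa [List.reverse_reverse] at this
  refine (esize_le_mul (n := esize L) fun t ht =>
    (esize_le_of_mem_sections ht).trans (esize_le_of_sublist hsub)).trans ?_
  -- An intermediate state of the fold consists of the choices from a part of `L`. The factors
  -- `l.length + 1` are positive, so the product over a part is at most the whole product; with the
  -- factors `l.length` an empty list would spoil this.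
  have h1 : l.reverse.sections.length ≤ (L.map fun l => l.length + 1).prod := by
    rw [length_sections]
    refine le_trans ?_ ((hsub.map fun l => l.length + 1).prod_le_prod' fun n hn => ?_)
    · exact List.prod_le_prod' fun l _ => Nat.le_succ _
    · obtain ⟨l, _, rfl⟩ := List.mem_map.1 hn
      exact Nat.le_add_left 1 _
  refine Nat.add_le_add_right (Nat.mul_le_mul ?_ ?_) 1 <;> omega

end closure

/-! ### Polynomial time for the ingredients of the procedure -/

section solve

variable {X : Type} [Enc X]

@[fun_prop]
theorem polyTime_touches {v : X → ℕ} {e : X → ℕ × ℕ} (hv : PolyTime v) (he : PolyTime e) :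
    PolyTime fun x => touches (v x) (e x) := by
  unfold touches; fun_prop

@[fun_prop]
theorem polyTime_meets {e f : X → ℕ × ℕ} (he : PolyTime e) (hf : PolyTime f) :
    PolyTime fun x => meets (e x) (f x) := by
  unfold meets; fun_prop

@[fun_prop]
theorem polyTime_expand {E R : X → List (ℕ × ℕ)} (hE : PolyTime E) (hR : PolyTime R) :
    PolyTime fun x => expand (E x) (R x) := by
  unfold expand; fun_prop

@[fun_prop]
theorem polyTime_degreeIn {K : X → List ((ℕ × ℕ) × ℕ)} {v : X → ℕ} (hK : PolyTime K)
    (hv : PolyTime v) : PolyTime fun x => degreeIn (K x) (v x) := by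
  unfold degreeIn; fun_prop

@[fun_prop]
theorem polyTime_addCandidate {D i : X → ℕ} {K : X → List ((ℕ × ℕ) × ℕ)} {e : X → ℕ × ℕ}
    (hD : PolyTime D) (hi : PolyTime i) (hK : PolyTime K) (he : PolyTime e) :
    PolyTime fun x => addCandidate (D x) (i x) (K x) (e x) := by
  unfold addCandidate; fun_prop

theorem esize_addCandidate_le (D i : ℕ) (K : List ((ℕ × ℕ) × ℕ)) (e : ℕ × ℕ) :
    esize (addCandidate D i K e) ≤ esize K + (esize e + esize i + 2) := by
  unfold addCandidate
  split_ifs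
  · rw [esize_cons, esize_prod]
    dsimp only
    omega
  · omega

theorem esize_foldl_addCandidate_le (D i : ℕ) (R : List (ℕ × ℕ)) (K : List ((ℕ × ℕ) × ℕ)) :
    esize (R.foldl (addCandidate D i) K) ≤ esize K + esize R * (esize i + 2) := by
  induction R generalizing K with
  | nil => simp
  | cons e R ih =>
    refine (ih _).trans ?_
    have h1 := esize_addCandidate_le D i K e
    have h2 := esize_pos i
    rw [esize_cons]
    nlinarith [esize_pos e]

@[fun_prop]
theorem polyTime_foldl_addCandidate {D i : X → ℕ} {R : X → List (ℕ × ℕ)}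
    {K : X → List ((ℕ × ℕ) × ℕ)} (hD : PolyTime D) (hi : PolyTime i) (hR : PolyTime R)
    (hK : PolyTime K) : PolyTime fun x => (R x).foldl (addCandidate (D x) (i x)) (K x) := by
  obtain ⟨q, hq, h⟩ := hR.size_bound
  obtain ⟨q', hq', h'⟩ := hi.size_bound
  refine PolyTime.foldl (h := fun x => addCandidate (D x) (i x)) hR hK (by fun_prop)
    ((hq.add hq').add (PolyBdd.const 2)) fun x b a ha => ?_
  have h1 := (esize_le_of_mem ha).trans (h x)
  have h2 := h' x
  have h3 := esize_addCandidate_le (D x) (i x) b a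
  omega

@[fun_prop]
theorem polyTime_searchStep {D i : X → ℕ} {E : X → List (ℕ × ℕ)}
    {s : X → List (ℕ × ℕ) × List ((ℕ × ℕ) × ℕ)} (hD : PolyTime D) (hE : PolyTime E)
    (hs : PolyTime s) (hi : PolyTime i) :
    PolyTime fun x => searchStep (D x) (E x) (s x) (i x) := by
  unfold searchStep; fun_prop

/-- The edges reached are always `[e]` or a sublist of `E`, so they do not accumulate, and each
round adds a bounded amount to the candidates. -/
theorem esize_search_le (D : ℕ) (E : List (ℕ × ℕ)) (e : ℕ × ℕ) (m n : ℕ) (hmn : m ≤ n) :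
    esize ((List.range m).foldl (searchStep D E) ([e], [])).1 ≤ esize E + esize e + 2 ∧
      esize ((List.range m).foldl (searchStep D E) ([e], [])).2 ≤
        1 + m * ((esize E + esize e + 2) * (2 * n + 3)) := by
  induction m with
  | zero => simp
  | succ m ih =>
    obtain ⟨h1, h2⟩ := ih (by omega)
    rw [List.range_succ, List.foldl_append, List.foldl_cons, List.foldl_nil]
    generalize (List.range m).foldl (searchStep D E) ([e], []) = s at h1 h2 ⊢
    refine ⟨?_, ?_⟩
    · have : esize (searchStep D E s m).1 ≤ esize E := esize_le_of_sublist List.filter_sublist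
      omega
    · refine (esize_foldl_addCandidate_le D m s.1 s.2).trans ?_
      have : esize s.1 * (esize m + 2) ≤ (esize E + esize e + 2) * (2 * n + 3) :=
        Nat.mul_le_mul h1 (by rw [esize_nat]; omega)
      rw [Nat.add_mul]
      omega

@[fun_prop]
theorem polyTime_candidates {D m : X → ℕ} {E : X → List (ℕ × ℕ)} {e : X → ℕ × ℕ}
    (hD : PolyTime D) (hE : PolyTime E) (hm : PolyTime m) (he : PolyTime e) :
    PolyTime fun x => candidates (D x) (E x) (m x) (e x) := by
  unfold candidates
  obtain ⟨q₁, hq₁, h₁⟩ := hE.size_bound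
  obtain ⟨q₂, hq₂, h₂⟩ := he.size_bound
  obtain ⟨q₃, hq₃, h₃⟩ := hm.size_bound
  refine PolyTime.snd (PolyTime.foldl_of_bound (h := fun x => searchStep (D x) (E x))
    (by fun_prop) (by fun_prop) (by fun_prop)
    (q := fun n => (q₁ n + q₂ n + 2) + (1 + q₃ n * ((q₁ n + q₂ n + 2) * (2 * q₃ n + 3))) + 1)
    ((((hq₁.add hq₂).add (PolyBdd.const 2)).add ((PolyBdd.const 1).add
      (hq₃.mul (((hq₁.add hq₂).add (PolyBdd.const 2)).mul
        (((PolyBdd.const 2).mul hq₃).add (PolyBdd.const 3)))))).add (PolyBdd.const 1))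
    fun x l hl => ?_)
  have hl' : l = List.range l.length := by
    have h := List.prefix_iff_eq_take.1 hl
    have hle := hl.length_le
    rw [List.length_range] at hle
    rw [List.take_range, min_eq_left hle] at h
    exact h
  have hle := hl.length_le
  rw [List.length_range] at hle
  have hm' := h₃ x
  rw [esize_nat] at hm'
  obtain ⟨g1, g2⟩ := esize_search_le (D x) (E x) (e x) l.length (q₃ (esize x)) (by omega)
  rw [← hl'] at g1 g2
  have e1 := h₁ x
  have e2 := h₂ x
  have e3 : l.length * ((esize (E x) + esize (e x) + 2) * (2 * q₃ (esize x) + 3)) ≤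
      q₃ (esize x) * ((q₁ (esize x) + q₂ (esize x) + 2) * (2 * q₃ (esize x) + 3)) :=
    Nat.mul_le_mul (by omega) (Nat.mul_le_mul_right _ (by omega))
  rw [esize_prod]
  omega

@[fun_prop]
theorem polyTime_readUnary {w : X → List Bool} (hw : PolyTime w) :
    PolyTime fun x => readUnary (w x) := by
  unfold readUnary
  refine PolyTime.foldl (h := fun _ s b => if b && s.1 then (true, s.2 + 1) else (false, s.2)) hw
    (by fun_prop) (by fun_prop) (PolyBdd.const 5) fun x s b _ => ?_
  have h1 := esize_pos s.1
  have h2 := esize_bool_le true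
  have h3 := esize_bool_le false
  split_ifs <;> simp only [esize_prod, esize_nat] <;> omega

@[fun_prop]
theorem polyTime_bitAt {n o u v : X → ℕ} {y : X → List Bool} (hn : PolyTime n) (ho : PolyTime o)
    (hy : PolyTime y) (hu : PolyTime u) (hv : PolyTime v) :
    PolyTime fun x => bitAt (n x) (o x) (y x) (u x) (v x) := by
  unfold bitAt; fun_prop

@[fun_prop]
theorem polyTime_edgeList {n o : X → ℕ} {y : X → List Bool} (hn : PolyTime n) (ho : PolyTime o)
    (hy : PolyTime y) : PolyTime fun x => edgeList (n x) (o x) (y x) := by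
  unfold edgeList; fun_prop

@[fun_prop]
theorem polyTime_isInstance {k n : X → ℕ} {y : X → List Bool} (hk : PolyTime k) (hn : PolyTime n)
    (hy : PolyTime y) : PolyTime fun x => isInstance (k x) (n x) (y x) := by
  unfold isInstance; fun_prop

@[fun_prop]
theorem polyTime_cappedValue {c : X → ℕ} {l : X → List Bool} (hc : PolyTime c) (hl : PolyTime l) :
    PolyTime fun x => cappedValue (c x) (l x) := by
  obtain ⟨q, hq, h⟩ := hc.size_bound
  unfold cappedValue
  simp only [List.foldr_eq_foldl_reverse]
  refine PolyTime.foldl_of_bound (h := fun x v (b : Bool) =>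
    if decide ((if b then 1 else 0) + (v + v) ≤ c x) then (if b then 1 else 0) + (v + v) else c x)
    (by fun_prop) (by fun_prop) (by fun_prop) hq fun x l _ => ?_
  refine le_trans ?_ (h x)
  rw [esize_nat, esize_nat]
  suffices H : ∀ (l : List Bool) (v : ℕ), v ≤ c x → l.foldl (fun v (b : Bool) =>
      if decide ((if b then 1 else 0) + (v + v) ≤ c x) then (if b then 1 else 0) + (v + v)
      else c x) v ≤ c x by
    have := H l 0 (Nat.zero_le _)
    omega
  intro l
  induction l with
  | nil => exact fun v hv => hv
  | cons b l ih =>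
    intro v hv
    refine ih _ ?_
    by_cases hb : (if b then 1 else 0) + (v + v) ≤ c x
    · simp only [decide_eq_true hb, if_true]
      exact hb
    · simp only [decide_eq_false hb, Bool.false_eq_true, if_false, le_refl]

@[fun_prop]
theorem polyTime_isDisjointTuple {t : X → List ((ℕ × ℕ) × ℕ)} (ht : PolyTime t) :
    PolyTime fun x => isDisjointTuple (t x) := by
  obtain ⟨q, hq, h⟩ := ht.size_bound
  unfold isDisjointTuple
  refine PolyTime.fst (PolyTime.foldl
    (h := fun _ s p => (s.1 && s.2.all fun e => !meets p.1 e, p.1 :: s.2)) ht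
    (by fun_prop) (by fun_prop) (hq.add (PolyBdd.const 4)) fun x s p hp => ?_)
  have h1 := esize_bool_le (s.1 && s.2.all fun e => !meets p.1 e)
  have h2 := (esize_le_of_mem hp).trans (h x)
  have h3 := esize_prod p
  rw [esize_prod, esize_prod, esize_cons]
  dsimp only
  omega

@[fun_prop]
theorem polyTime_isSolution {l : X → List Bool} {t : X → List ((ℕ × ℕ) × ℕ)} (hl : PolyTime l)
    (ht : PolyTime t) : PolyTime fun x => isSolution (l x) (t x) := by
  unfold isSolution; fun_prop

@[fun_prop]
theorem polyTime_candidateLists {k n : X → ℕ} {y : X → List Bool} (hk : PolyTime k)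
    (hn : PolyTime n) (hy : PolyTime y) :
    PolyTime fun x => candidateLists (k x) (n x) (y x) := by
  unfold candidateLists; fun_prop

theorem polyTimeIn_hasSolution :
    PolyTimeIn (fun p : List Bool × List (List ((ℕ × ℕ) × ℕ)) =>
      (p.2.map fun l => l.length + 1).prod) fun p => hasSolution p.1 p.2 := by
  have h1 : PolyTimeIn (fun p : List Bool × List (List ((ℕ × ℕ) × ℕ)) =>
      (p.2.map fun l => l.length + 1).prod) fun p => p.2.sections :=
    polyTimeIn_sections.comp (PolyTime.snd'.polyTimeIn _) PolyBdd.id fun p => Nat.le_add_left _ _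
  have h2 : PolyTime fun p : List Bool × List (List ((ℕ × ℕ) × ℕ)) =>
    p.2.any fun t => isSolution p.1 t := by fun_prop
  exact h2.comp_in ((PolyTime.fst'.polyTimeIn _).prodMk h1)

/-- A bound on the number of choices of candidates for `k` tokens. -/
def choiceBound (k : ℕ) : ℕ := (2 * k * (2 * k) + 2) ^ k

/-- On words that pass the checks there are exactly `k` candidate lists, each contributing a factor
of at most `(2 * k) ^ 2 + 2` to the measure. On all other words the list of lists is empty and the
measure is `1`. -/
theorem polyTimeIn_solve : PolyTimeIn (fun w => choiceBound (readUnary w).2) solve := by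
  have h1 : PolyTime fun w => !(parse w).1 && isInstance (parse w).2.1 (parse w).2.2.1 (parse w).2.2.2 := by
    fun_prop
  have h2 : PolyTime fun w => ((parse w).2.2.2.drop ((parse w).2.2.1 * (parse w).2.2.1 +
      (parse w).2.2.1 * (parse w).2.2.1),
      if (!(parse w).1 && isInstance (parse w).2.1 (parse w).2.2.1 (parse w).2.2.2) = true then
        candidateLists (parse w).2.1 (parse w).2.2.1 (parse w).2.2.2 else []) := by
    fun_prop
  have h3 := polyTimeIn_hasSolution.comp
    (h2.polyTimeIn fun w => choiceBound (readUnary w).2) (PolyBdd.id.add (PolyBdd.const 1))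
    fun w => by
      dsimp only
      split_ifs with h
      · rw [Bool.and_eq_true] at h
        have hk := h.2
        unfold isInstance at hk
        rw [Bool.and_eq_true, decide_eq_true_eq] at hk
        have hprod : ∀ l ∈ (candidateLists (parse w).2.1 (parse w).2.2.1 (parse w).2.2.2).map
            (fun l => l.length + 1), l ≤ 2 * (parse w).2.1 * (2 * (parse w).2.1) + 2 := by
          intro l hl
          obtain ⟨c, hc, rfl⟩ := List.mem_map.1 hl
          obtain ⟨e, _, rfl⟩ := List.mem_map.1 hc
          exact Nat.succ_le_succ (length_candidates_le _ _)
        have := List.prod_le_pow_card _ _ hprod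
        rw [List.length_map, candidateLists, List.length_map, hk.2] at this
        refine this.trans ?_
        change choiceBound (readUnary w).2 ≤ _
        omega
      · simp
  have h4 := (by fun_prop : PolyTime fun p : Bool × Bool => p.1 && p.2).comp_in
    ((h1.polyTimeIn fun w => choiceBound (readUnary w).2).prodMk h3)
  exact h4

end solve

theorem computable_choiceBound (c : ℕ) : Computable fun k => (choiceBound k + 32) ^ c := by
  have hpow : Primrec₂ fun a b : ℕ => a ^ b := by
    have : Primrec₂ fun (a : ℕ) (b : ℕ) => Nat.rec (motive := fun _ => ℕ) 1 (fun _ r => r * a) b :=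
      Primrec.nat_rec (Primrec.const 1)
        (Primrec.nat_mul.comp (Primrec.snd.comp Primrec.snd) Primrec.fst).to₂
    refine this.of_eq fun a b => ?_
    induction b with
    | zero => rfl
    | succ b ih => rw [pow_succ, ← ih]
  have h2 : Primrec fun k : ℕ => 2 * k := Primrec.nat_mul.comp (Primrec.const 2) Primrec.id
  have h : Primrec choiceBound :=
    hpow.comp (Primrec.nat_add.comp (Primrec.nat_mul.comp h2 h2) (Primrec.const 2)) Primrec.id
  exact (hpow.comp (Primrec.nat_add.comp h (Primrec.const 32)) (Primrec.const c)).to_comp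

theorem esize_word_le (w : List Bool) : esize w ≤ 4 * w.length + 1 := by
  refine (esize_le_mul (n := 3) fun b _ => esize_bool_le b).trans ?_
  omega

theorem mainTheorem8 : matchingDiscoverySliding.IsFPT := by
  obtain ⟨p, q, ⟨hq, c, hc⟩, h⟩ := polyTimeIn_solve
  refine ⟨Prog.toMachine (Prog.seq Prog.readWord (Prog.seq p Prog.writeBool)),
    fun k => (choiceBound k + 32) ^ (c + 1), c + 1, fun _ => inferInstanceAs (Finite Bool),
    computable_choiceBound (c + 1), fun x k => ?_⟩
  refine ⟨solve (instanceWord x k), mem_matchingDiscoverySliding_iff x k, ?_⟩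
  refine Prog.Maps.answersWithin (h (instanceWord x k)).2 ?_
  have hk : (readUnary (instanceWord x k)).2 = k := by rw [instanceWord, readUnary_eq]
  dsimp only
  rw [hk]
  have hpos : 1 ≤ (instanceWord x k).length := by simp [instanceWord]; omega
  have hsize := esize_word_le (instanceWord x k)
  generalize (instanceWord x k).length = N at hpos hsize
  generalize choiceBound k = g
  generalize esize (instanceWord x k) = s at hsize
  -- Since `s ≤ 4 * N + 1` and `1 ≤ N`, the base `s + g + 2` is at most `(g + 7) * N`.
  have h1 : q (s + g) ≤ ((g + 7) * N) ^ c := (hc _).trans (Nat.pow_le_pow_left (by nlinarith) c)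
  have h2 : ((g + 7) * N) ^ c ≤ ((g + 32) * N) ^ c :=
    Nat.pow_le_pow_left (Nat.mul_le_mul_right _ (by omega)) c
  have h3 : 1 ≤ ((g + 32) * N) ^ c := Nat.one_le_pow _ _ (by positivity)
  -- Reading the input and writing the output cost `10 * N + 11 ≤ 21 * N`; the constant `32 = 1 +
  -- 31` leaves room to absorb this in one further factor `(g + 32) * N`.
  calc q (s + g) + 10 * N + 11 ≤ ((g + 32) * N) ^ c * 1 + 21 * N := by omega
    _ ≤ ((g + 32) * N) ^ c * N + ((g + 32) * N) ^ c * (31 * N) :=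
      Nat.add_le_add (Nat.mul_le_mul_left _ hpos)
        ((Nat.mul_le_mul_right N (by omega)).trans (Nat.le_mul_of_pos_left _ h3))
    _ = ((g + 32) * N) ^ c * (32 * N) := by ring
    _ ≤ ((g + 32) * N) ^ c * ((g + 32) * N) :=
      Nat.mul_le_mul_left _ (Nat.mul_le_mul_right _ (by omega))
    _ = (g + 32) ^ (c + 1) * N ^ (c + 1) := by rw [← pow_succ, mul_pow]
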